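/- Let $G$ be a finite-dimensional real Lie group with Lie algebra $\mathfrak{g}=\mathfrak{k}\oplus\mathfrak{p}$ (a direct sum of vector subspaces), and let $e_0\in\mathfrak{p}$, $T>0$, $g_0,g_T\in G$, $\alpha_0\in\mathfrak{g}^*$. Write $\mathrm{Ad}^*_g\alpha=\alpha\circ\mathrm{Ad}_g$ and $\mathrm{ad}^*_u\alpha=\alpha\circ\mathrm{ad}_u$, and regard $\mathfrak{k}^*,\mathfrak{p}^*$ as subspaces of $\mathfrak{g}^*$ through the splitting. Let $C:G\times\mathfrak{k}\to\mathbb{R}$ and $V_{\rm ext}:G\times\mathfrak{g}^*\to\mathbb{R}$ be $C^1$ functions with $C(gh,v)=C(h,v)$ and $V_{\rm ext}(gh,\mathrm{Ad}^*_{g^{-1}}\alpha)=V_{\rm ext}(h,\alpha)$ for all $g,h\in G$, $v\in\mathfrak{k}$, $\alpha\in\mathfrak{g}^*$. Consider the problem of minimizing $\int_0^T[C(g,u-e_0)+V_{\rm ext}(g,\alpha_0)]\,dt$ subject to $\dot g=T_eL_g(u)$, $u(t)\in e_0+\mathfrak{k}$, $g(0)=g_0$, $g(T)=g_T$, with $g\in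 C^1([0,T],G)$. A normal extremal with multiplier $\lambda\in C^1([0,T],\mathfrak{p}^*)$ is a pair $(g,u)$ satisfying these constraints such that $\delta\int_0^T[C(g,\pi_{\mathfrak{k}}(u-e_0))+V_{\rm ext}(g,\alpha_0)+\langle\lambda,\pi_{\mathfrak p}(u-e_0)\rangle]\,dt=0$ for all $C^1$ variations of $g$ with fixed end points and the induced variations of $u=T_gL_{g^{-1}}(\dot g)\in\mathfrak{g}$, where $\lambda$ is held fixed and $\pi_{\mathfrak{k}},\pi_{\mathfrak{p}}$ are the projections of $\mathfrak{g}=\mathfrak{k}\oplus\mathfrak{p}$. Here a $C^1$ variation is a family of curves $g_s$, $|s|<\varepsilon$, jointly $C^1$ in $(s,t)$, whose velocity $u_s=T_{g_s}L_{g_s^{-1}}(\dot g_s)$ is continuous in $(s,t)$ and has a continuous derivative in $s$. For a representation $\rho$ of $G$ on a finite-dimensional space $X$, let $\rho'$ be the induced representation of $\mathfrak{g}$, $\rho^*_g,\rho'^*_\xi$ the adjoints of $\rho_g,\rho'_\xi$, and $\mathbf{J}_X:X\times X^*\to\mathfrak{g}^*$ the momentum map $\langle\mathbf{J}_X(x,\alpha),\xi\rangle=\langle\alpha,\xi_X(x)\rangle$,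 where $\xi_X$ is the infinitesimal generator. Write $\frac{\partial C}{\partial u}\in\mathfrak{k}^*$ for the derivative of $C(e,\cdot)$ at $u-e_0$ and $\frac{\partial V_{\rm ext}}{\partial\alpha}\in X^{**}\cong X$ for the derivative of $V_{\rm ext}(e,\cdot)$ at $\alpha$. Take $X=\mathfrak{g}$ and $\rho=\mathrm{Ad}$. Then: (1) $\mathbf{J}_X(x,\alpha)=-\mathrm{ad}^*_x\alpha$ for all $x\in\mathfrak{g}$, $\alpha\in\mathfrak{g}^*$. (2) For all curves $u,\lambda,\alpha$ in $\mathfrak{g},\mathfrak{p}^*,\mathfrak{g}^*$, the Euler–Poincaré equations $$\frac{d}{dt}\Big(\frac{\partial C}{\partial u}+\lambda\Big)=\mathrm{ad}^*_u\Big(\frac{\partial C}{\partial u}+\lambda\Big)+\mathbf{J}_X\Big(\frac{\partial V_{\rm ext}}{\partial\alpha},\alpha\Big),\qquad \dot\alpha=\rho'^*_u\alpha,\qquad \alpha(0)=\rho^*_{g_0}\alpha_0$$ on $[0,T]$ are equivalent to $$\frac{d}{dt}\Big(\frac{\partial C}{\partial u}+\lambda\Big)=\mathrm{ad}^*_u\Big(\frac{\partial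 C}{\partial u}+\lambda\Big)-\mathrm{ad}^*_{\frac{\partial V_{\rm ext}}{\partial\alpha}}\alpha,\qquad \dot\alpha=\mathrm{ad}^*_u\alpha,\qquad \alpha(0)=\mathrm{Ad}^*_{g_0}\alpha_0 .$$ (3) Every normal extremal $(g,u)$ with multiplier $\lambda$ satisfies the latter equations on $[0,T]$, with $\alpha(t)=\mathrm{Ad}^*_{g(t)}\alpha_0$. -/

import Mathlib

open Set
open scoped Manifold ContDiff

noncomputable section

namespace SymmetryBreaking

/-! Throughout, `G` is a real finite-dimensional Lie group modelled on the vector space `E`, of the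
smoothness class required by Mathlib for its Lie algebra (`minSmoothness ℝ 3 = 3`, so that smooth
Lie groups are included).  In Mathlib the tangent space `T_e G` is, as a topological vector space,
the model space `E` itself; so the Lie algebra `𝔤` of `G` is `E` with the bracket of
`GroupLieAlgebra 𝓘(ℝ, E) G`, and the dual space `𝔤*` is `E →L[ℝ] ℝ`. -/

section LieGroup

variable {E : Type*} [NormedAddCommGroup E] [NormedSpace ℝ E]

/-- The tangent map `T_e L_g : 𝔤 → T_g G` of the left translation by `g`, applied to `u`. -/
def leftTranslate {G : Type*} [TopologicalSpace G] [ChartedSpace E G] [Group G]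
    (g : G) (u : E) : TangentSpace 𝓘(ℝ, E) g :=
  mulInvariantVectorField (I := 𝓘(ℝ, E)) (G := G) (u : GroupLieAlgebra 𝓘(ℝ, E) G) g

variable [FiniteDimensional ℝ E]
variable (G : Type*) [TopologicalSpace G] [ChartedSpace E G] [Group G]
  [LieGroup 𝓘(ℝ, E) (minSmoothness ℝ 3) G]

/-- The Lie bracket of the Lie algebra of `G`, i.e. the bracket of left-invariant vector fields. -/
def bracket (u v : GroupLieAlgebra 𝓘(ℝ, E) G) : GroupLieAlgebra 𝓘(ℝ, E) G := ⁅u, v⁆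

/-- The adjoint endomorphism `ad_u v = [u, v]` of the Lie algebra of `G`. -/
def ad (u : E) : E →L[ℝ] E :=
  LinearMap.toContinuousLinearMap (𝕜 := ℝ) (E := E) (F' := E)
    { toFun := fun v => bracket G u v
      map_add' := by
        have : CompleteSpace E := FiniteDimensional.complete ℝ E
        intro v w
        exact lie_add (L := GroupLieAlgebra 𝓘(ℝ, E) G) (M := GroupLieAlgebra 𝓘(ℝ, E) G) u v w
      map_smul' := by
        have : CompleteSpace E := FiniteDimensional.complete ℝ E
        intro c v
        exact lie_smul (L := GroupLieAlgebra 𝓘(ℝ, E) G) (M := GroupLieAlgebra 𝓘(ℝ, E) G) c u v }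

theorem ad_apply (u v : E) : ad G u v = bracket G u v := rfl

/-- The dual map `ad*_u : 𝔤* → 𝔤*`, `⟨ad*_u μ, v⟩ = ⟨μ, ad_u v⟩`. -/
def adDual (u : E) (μ : E →L[ℝ] ℝ) : E →L[ℝ] ℝ := μ.comp (ad G u)

variable (E)

/-- `Ad_g : 𝔤 → 𝔤`, the tangent map at the identity of the conjugation `x ↦ g x g⁻¹`. -/
def AdMap {G : Type*} [TopologicalSpace G] [ChartedSpace E G] [Group G] (g : G) : E →L[ℝ] E :=
  mfderiv 𝓘(ℝ, E) 𝓘(ℝ, E) (fun x : G => g * x * g⁻¹) 1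

/-- The adjoint representation `g ↦ Ad_g` of `G` on its Lie algebra. -/
def Ad : G →* (E →L[ℝ] E) where
  toFun := AdMap E
  map_one' := by
    have h : (fun x : G => (1 : G) * x * (1 : G)⁻¹) = id := by ext x; simp
    unfold AdMap
    rw [h]
    exact mfderiv_id
  map_mul' g h := by
    have M : minSmoothness ℝ 3 ≠ 0 := lt_of_lt_of_le (by simp) le_minSmoothness |>.ne'
    have hd : ∀ (a y : G), MDifferentiableAt 𝓘(ℝ, E) 𝓘(ℝ, E) (fun x : G => a * x * a⁻¹) y :=
      fun a y => ((contMDiff_mul_left (I := 𝓘(ℝ, E)) (n := minSmoothness ℝ 3) (a := a)).mul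
        contMDiff_const).contMDiffAt.mdifferentiableAt M
    have key : ∀ y : G, y = 1 →
        (mfderiv 𝓘(ℝ, E) 𝓘(ℝ, E) (fun x : G => g * x * g⁻¹) y : E →L[ℝ] E) = AdMap E g := by
      rintro _ rfl
      rfl
    have hc : (fun x : G => g * h * x * (g * h)⁻¹)
        = (fun x : G => g * x * g⁻¹) ∘ (fun x : G => h * x * h⁻¹) := by
      ext x
      simp [mul_assoc]
    have h1 : h * 1 * h⁻¹ = (1 : G) := by simp
    have := mfderiv_comp (I := 𝓘(ℝ, E)) (I' := 𝓘(ℝ, E)) (I'' := 𝓘(ℝ, E)) (1 : G)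
      (hd g (h * 1 * h⁻¹)) (hd h 1)
    rw [← hc] at this
    refine Eq.trans this ?_
    rw [← key _ h1]
    rfl

end LieGroup

section Representation

variable {E : Type*} [NormedAddCommGroup E] [NormedSpace ℝ E]
variable {G : Type*} [TopologicalSpace G] [ChartedSpace E G] [Group G]
variable {X : Type*} [NormedAddCommGroup X] [NormedSpace ℝ X]

/-- The adjoint `ρ*_g : X* → X*` of `ρ_g`, `⟨ρ*_g α, x⟩ = ⟨α, ρ_g x⟩`. -/
def dualRep (ρ : G →* (X →L[ℝ] X)) (g : G) (α : X →L[ℝ] ℝ) : X →L[ℝ] ℝ := α.comp (ρ g)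

/-- The representation `ρ' : 𝔤 → 𝔤𝔩(X)` induced by `ρ`, i.e. the tangent map of `ρ` at `e`. -/
def inducedRep (ρ : G →* (X →L[ℝ] X)) (ξ : E) : X →L[ℝ] X :=
  mfderiv 𝓘(ℝ, E) 𝓘(ℝ, X →L[ℝ] X) (fun g : G => ρ g) 1 ξ

/-- The adjoint `ρ'*_ξ : X* → X*` of `ρ'_ξ`. -/
def inducedDualRep (ρ : G →* (X →L[ℝ] X)) (ξ : E) (α : X →L[ℝ] ℝ) : X →L[ℝ] ℝ :=
  α.comp (inducedRep ρ ξ)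

/-- The infinitesimal generator `ξ_X` of the action `(g, x) ↦ ρ_g x` of `G` on `X`: the vector
`ξ_X(x)` is the image of `ξ` under the tangent map at `e` of the orbit map `g ↦ ρ_g x`. -/
def infinitesimalGenerator (ρ : G →* (X →L[ℝ] X)) (ξ : E) (x : X) : X :=
  mfderiv 𝓘(ℝ, E) 𝓘(ℝ, X) (fun g : G => ρ g x) 1 ξ

/-- The momentum map `J_X : X × X* → 𝔤*`, `⟨J_X(x, α), ξ⟩ = ⟨α, ξ_X(x)⟩`. -/
def momentumMap (ρ : G →* (X →L[ℝ] X)) (x : X) (α : X →L[ℝ] ℝ) : E →L[ℝ] ℝ :=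
  α.comp (mfderiv 𝓘(ℝ, E) 𝓘(ℝ, X) (fun g : G => ρ g x) 1 : E →L[ℝ] X)

theorem momentumMap_apply (ρ : G →* (X →L[ℝ] X)) (x : X) (α : X →L[ℝ] ℝ) (ξ : E) :
    momentumMap ρ x α ξ = α (infinitesimalGenerator ρ ξ x) := rfl

end Representation

/-- For a function `F` on the dual of a finite-dimensional space `X`, the derivative `∂F/∂α` at `α`,
an element of `X** = X`. -/
def dualGradient {X : Type*} [NormedAddCommGroup X] [NormedSpace ℝ X] [FiniteDimensional ℝ X]
    (F : (X →L[ℝ] ℝ) → ℝ) (α : X →L[ℝ] ℝ) : X :=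
  (Module.evalEquiv ℝ X).symm
    ((fderiv ℝ F α).toLinearMap ∘ₗ
      (LinearMap.toContinuousLinearMap : (X →ₗ[ℝ] ℝ) ≃ₗ[ℝ] (X →L[ℝ] ℝ)).toLinearMap)

theorem apply_dualGradient {X : Type*} [NormedAddCommGroup X] [NormedSpace ℝ X]
    [FiniteDimensional ℝ X] (F : (X →L[ℝ] ℝ) → ℝ) (α β : X →L[ℝ] ℝ) :
    β (dualGradient F α) = fderiv ℝ F α β := by
  have h : Module.evalEquiv ℝ X (dualGradient F α) (β : X →ₗ[ℝ] ℝ) = β (dualGradient F α) := by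
    simp
  rw [← h, dualGradient, LinearEquiv.apply_symm_apply]
  rfl

/-- The data of the optimal control problem: minimize `∫₀ᵀ [C(g, u - e₀) + V(g)] dt` subject to
`ġ = T_e L_g (u)`, `g(0) = g₀`, `g(T) = g_T`, where `u` takes its values in `e₀ + 𝔨`.
Here `𝔤 = 𝔨 ⊕ 𝔭`, `e₀ ∈ 𝔭`, and `V = Vext(·, α₀)` depends on a parameter `α₀ ∈ X*`. -/
structure ControlProblem (E : Type*) [NormedAddCommGroup E] [NormedSpace ℝ E]
    (G : Type*) (X : Type*) [NormedAddCommGroup X] [NormedSpace ℝ X] where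
  /-- the subspace of control directions -/
  k : Submodule ℝ E
  /-- the complementary subspace -/
  p : Submodule ℝ E
  isCompl : IsCompl k p
  /-- the drift -/
  e₀ : E
  e₀_mem : e₀ ∈ p
  /-- the final time -/
  T : ℝ
  T_pos : 0 < T
  /-- the initial point -/
  g₀ : G
  /-- the final point -/
  gT : G
  /-- the invariant part of the cost, a function on `G × 𝔨` -/
  C : G → k → ℝ
  /-- the extended potential function, a function on `G × X*` -/
  Vext : G → (X →L[ℝ] ℝ) → ℝ
  /-- the parameter -/
  α₀ : X →L[ℝ] ℝ

namespace ControlProblem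

variable {E : Type*} [NormedAddCommGroup E] [NormedSpace ℝ E] [FiniteDimensional ℝ E]
variable {G : Type*} [TopologicalSpace G] [ChartedSpace E G] [Group G]
variable {X : Type*} [NormedAddCommGroup X] [NormedSpace ℝ X]

/-- The standing assumptions: `C` and `Vext` are continuously differentiable, `C` is invariant under
`(h, u) ↦ (g h, u)`, and `Vext` is invariant under `(h, α) ↦ (g h, ρ*_{g⁻¹} α)`. -/
structure Assumptions (P : ControlProblem E G X) (ρ : G →* (X →L[ℝ] X)) : Prop where
  contMDiff_C : ContMDiff (𝓘(ℝ, E).prod 𝓘(ℝ, P.k)) 𝓘(ℝ, ℝ) 1 (fun q : G × P.k => P.C q.1 q.2)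
  contMDiff_Vext : ContMDiff (𝓘(ℝ, E).prod 𝓘(ℝ, X →L[ℝ] ℝ)) 𝓘(ℝ, ℝ) 1
    (fun q : G × (X →L[ℝ] ℝ) => P.Vext q.1 q.2)
  C_invariant : ∀ (g h : G) (v : P.k), P.C (g * h) v = P.C h v
  Vext_invariant : ∀ (g h : G) (α : X →L[ℝ] ℝ), P.Vext (g * h) (dualRep ρ g⁻¹ α) = P.Vext h α

/-- The projection of `𝔤 = 𝔨 ⊕ 𝔭` onto `𝔨`. -/
def projK (P : ControlProblem E G X) : E →L[ℝ] P.k :=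
  LinearMap.toContinuousLinearMap (P.k.projectionOnto P.p P.isCompl)

/-- The projection of `𝔤 = 𝔨 ⊕ 𝔭` onto `𝔭`. -/
def projP (P : ControlProblem E G X) : E →L[ℝ] P.p :=
  LinearMap.toContinuousLinearMap (P.p.projectionOnto P.k P.isCompl.symm)

/-- The augmented Lagrangian `L_a(g, u, λ, α) = C(g, u - e₀) + Vext(g, α) + ⟨λ, u - e₀⟩`, defined
for all `u ∈ 𝔤`: the cost sees the `𝔨`-part of `u - e₀`, and the multiplier `λ ∈ 𝔭*` its
`𝔭`-part, whose vanishing is the constraint on `u`. -/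
def augmentedLagrangian (P : ControlProblem E G X) (g : G) (u : E) (l : P.p →L[ℝ] ℝ)
    (α : X →L[ℝ] ℝ) : ℝ :=
  P.C g (P.projK (u - P.e₀)) + P.Vext g α + l (P.projP (u - P.e₀))

/-- The covector `∂C/∂u + λ ∈ 𝔤*`, where `∂C/∂u ∈ 𝔨*` is the derivative of `C(e, ·)` at `u - e₀`,
and where `𝔨*` and `𝔭*` are subspaces of `𝔤*` through the splitting `𝔤 = 𝔨 ⊕ 𝔭`. -/
def costMomentum (P : ControlProblem E G X) (u : E) (l : P.p →L[ℝ] ℝ) : E →L[ℝ] ℝ :=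
  (fderiv ℝ (P.C 1) (P.projK (u - P.e₀))).comp P.projK + l.comp P.projP

end ControlProblem

section Extremals

variable {E : Type*} [NormedAddCommGroup E] [NormedSpace ℝ E]
variable {G : Type*} [TopologicalSpace G] [ChartedSpace E G] [Group G]
variable {X : Type*} [NormedAddCommGroup X] [NormedSpace ℝ X]

/-- `g ∈ C¹([0, T], G)`, and `u` is the continuous curve in `𝔤` with `ġ = T_e L_g (u)`. -/
structure IsTrajectory (T : ℝ) (g : ℝ → G) (u : ℝ → E) : Prop where
  contMDiffOn : ContMDiffOn 𝓘(ℝ, ℝ) 𝓘(ℝ, E) 1 g (Icc 0 T)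
  continuousOn : ContinuousOn u (Icc 0 T)
  velocity : ∀ t ∈ Icc 0 T, HasMFDerivWithinAt 𝓘(ℝ, ℝ) 𝓘(ℝ, E) g (Icc 0 T) t
    (ContinuousLinearMap.toSpanSingleton ℝ (leftTranslate (g t) (u t)))

/-- A variation of the trajectory `(g, u)`: a `C¹` family `γ s`, `|s| < ε`, of curves on `[0, T]`
with the end points of `g`, and with `γ 0 = g`, together with their velocities
`w s = T L_{(γ s)⁻¹} (d(γ s)/dt)`, which are continuously differentiable in `s`. -/
structure IsVariation (T : ℝ) (g : ℝ → G) (u : ℝ → E) (ε : ℝ) (γ : ℝ → ℝ → G) (w : ℝ → ℝ → E) :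
    Prop where
  pos : 0 < ε
  curve_zero : ∀ t ∈ Icc 0 T, γ 0 t = g t
  velocity_zero : ∀ t ∈ Icc 0 T, w 0 t = u t
  left_end : ∀ s ∈ Ioo (-ε) ε, γ s 0 = g 0
  right_end : ∀ s ∈ Ioo (-ε) ε, γ s T = g T
  trajectory : ∀ s ∈ Ioo (-ε) ε, IsTrajectory T (γ s) (w s)
  contMDiffOn : ContMDiffOn 𝓘(ℝ, ℝ × ℝ) 𝓘(ℝ, E) 1 (fun q : ℝ × ℝ => γ q.1 q.2)
    (Ioo (-ε) ε ×ˢ Icc 0 T)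
  continuousOn_velocity : ContinuousOn (fun q : ℝ × ℝ => w q.1 q.2) (Ioo (-ε) ε ×ˢ Icc 0 T)
  exists_deriv : ∃ w' : ℝ → ℝ → E,
    (∀ s ∈ Ioo (-ε) ε, ∀ t ∈ Icc 0 T, HasDerivAt (fun r => w r t) (w' s t) s) ∧
    ContinuousOn (fun q : ℝ × ℝ => w' q.1 q.2) (Ioo (-ε) ε ×ˢ Icc 0 T)

/-- `(g, u)` is admissible for the control problem: it is a trajectory of the left-invariant control
system with controls in `e₀ + 𝔨`, and it joins the prescribed end points. -/
structure IsAdmissible (P : ControlProblem E G X) (g : ℝ → G) (u : ℝ → E) : Prop where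
  trajectory : IsTrajectory P.T g u
  control : ∀ t ∈ Icc 0 P.T, u t - P.e₀ ∈ P.k
  left_end : g 0 = P.g₀
  right_end : g P.T = P.gT

variable [FiniteDimensional ℝ E]

/-- `(g, u)` is a normal extremal of the control problem, with multiplier
`λ ∈ C¹([0, T], 𝔭*)`: it is admissible, and `δ ∫₀ᵀ L_a(g, u, λ, α₀) dt = 0` for all variations of
`g` that vanish at the end points and the induced variations of `u`. -/
structure IsNormalExtremal (P : ControlProblem E G X) (g : ℝ → G) (u : ℝ → E)
    (l : ℝ → P.p →L[ℝ] ℝ) : Prop where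
  admissible : IsAdmissible P g u
  contDiffOn : ContDiffOn ℝ 1 l (Icc 0 P.T)
  critical : ∀ (ε : ℝ) (γ : ℝ → ℝ → G) (w : ℝ → ℝ → E), IsVariation P.T g u ε γ w →
    HasDerivAt (fun s => ∫ t in (0 : ℝ)..P.T, P.augmentedLagrangian (γ s t) (w s t) (l t) P.α₀) 0 0

end Extremals

section Equations

variable {E : Type*} [NormedAddCommGroup E] [NormedSpace ℝ E] [FiniteDimensional ℝ E]
variable {G : Type*} [TopologicalSpace G] [ChartedSpace E G] [Group G]
  [LieGroup 𝓘(ℝ, E) (minSmoothness ℝ 3) G]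
variable {X : Type*} [NormedAddCommGroup X] [NormedSpace ℝ X] [FiniteDimensional ℝ X]

/-- The Euler-Poincaré equations on `[0, T]` for a general representation `ρ`:
`d/dt (∂C/∂u + λ) = ad*_u (∂C/∂u + λ) + J_X(∂Vext/∂α, α)`, `α̇ = ρ'*_u α`, `α(0) = ρ*_{g₀} α₀`. -/
structure EulerPoincareEquations (P : ControlProblem E G X) (ρ : G →* (X →L[ℝ] X))
    (u : ℝ → E) (l : ℝ → P.p →L[ℝ] ℝ) (α : ℝ → X →L[ℝ] ℝ) : Prop where
  momentum : ∀ t ∈ Icc 0 P.T, HasDerivWithinAt (fun s => P.costMomentum (u s) (l s))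
    (adDual G (u t) (P.costMomentum (u t) (l t))
      + momentumMap ρ (dualGradient (P.Vext 1) (α t)) (α t)) (Icc 0 P.T) t
  advection : ∀ t ∈ Icc 0 P.T, HasDerivWithinAt α (inducedDualRep ρ (u t) (α t)) (Icc 0 P.T) t
  initial : α 0 = dualRep ρ P.g₀ P.α₀

/-- The equations
`d/dt (∂C/∂u + λ) = ad*_u (∂C/∂u + λ) - ad*_{∂Vext/∂α} α`, `α̇ = ad*_u α`, `α(0) = Ad*_{g₀} α₀`
on `[0, T]`, in the case `X = 𝔤`. -/
structure AdjointEulerPoincareEquations (P : ControlProblem E G E)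
    (u : ℝ → E) (l : ℝ → P.p →L[ℝ] ℝ) (α : ℝ → E →L[ℝ] ℝ) : Prop where
  momentum : ∀ t ∈ Icc 0 P.T, HasDerivWithinAt (fun s => P.costMomentum (u s) (l s))
    (adDual G (u t) (P.costMomentum (u t) (l t))
      - adDual G (dualGradient (P.Vext 1) (α t)) (α t)) (Icc 0 P.T) t
  advection : ∀ t ∈ Icc 0 P.T, HasDerivWithinAt α (adDual G (u t) (α t)) (Icc 0 P.T) t
  initial : α 0 = P.α₀.comp (Ad E G P.g₀)

end Equations

end SymmetryBreaking

end

open SymmetryBreaking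

/-! The sign in the momentum map and the bracket terms in the equations come from one fact,
`tangentMapAt_AdMap_apply`: the derivative at `e` of `g ↦ Ad_g` is `ad`, where the bracket is that
of left-invariant vector fields. It is proved in a chart at `e` by differentiating `Ad`, `L` and `R`
in the identity `L_g = R_g ∘ Ad_g` and using the symmetry of the second derivative of the product.
Hence the generator of the adjoint action is `ξ_X(x) = [ξ, x] = -[x, ξ]`, which gives the momentum
map, and then the two systems agree term by term.

For the extremals, invariance turns the Lagrangian into a function of `u` and of `α = Ad*_g α₀`
(`augmentedLagrangian_eq`). The variations `g(t) c(s f(t))`, with `c` a curve through `e` of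
velocity `v` and `f` vanishing at `0` and `T`, give `δu = f' v + f [u, v]` and `δα = f ad*_v α`.
With `m = ∂C/∂u + λ`, criticality becomes the weak equation `∫ (f' m(v) + f q(v)) dt = 0`, where `q
= ad*_u m - ad*_{∂V/∂α} α` (`IsNormalExtremal.integral_eq_zero`). The lemma of du Bois-Reymond then
shows that `m` is differentiable with derivative `q`; no differentiability of `u` is needed. The
advection equation is the derivative of `Ad` along the curve `g`. -/

namespace SymmetryBreaking

/-! ### Calculus of variations: differentiation under the integral and du Bois-Reymond. -/

section CalculusOfVariations

open MeasureTheory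

/-- Differentiation under the integral sign for jointly continuous derivatives. -/
theorem hasDerivAt_intervalIntegral_of_continuous {F F' : ℝ → ℝ → ℝ} {a b : ℝ}
    (hF : ∀ s t, HasDerivAt (fun r => F r t) (F' s t) s)
    (hc : ∀ s, Continuous (F s)) (hc' : Continuous (fun q : ℝ × ℝ => F' q.1 q.2)) (s₀ : ℝ) :
    HasDerivAt (fun s => ∫ t in a..b, F s t) (∫ t in a..b, F' s₀ t) s₀ := by
  -- The dominating function is a constant: the joint derivative is bounded on the compact product
  -- of a unit ball about `s₀` with the interval.
  obtain ⟨K, hK⟩ := ((isCompact_closedBall s₀ 1).prod (isCompact_uIcc (a := a) (b := b))).exists_bound_of_continuousOn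
    hc'.continuousOn
  refine (intervalIntegral.hasDerivAt_integral_of_dominated_loc_of_deriv_le (s := Metric.closedBall s₀ 1)
    (bound := fun _ => K) (Metric.closedBall_mem_nhds s₀ one_pos) ?_ ?_ ?_ ?_ ?_ ?_).2
  · exact Filter.Eventually.of_forall fun s => (hc s).aestronglyMeasurable
  · exact (hc s₀).intervalIntegrable a b
  · exact (hc'.comp (Continuous.prodMk_right s₀)).aestronglyMeasurable
  · exact Filter.Eventually.of_forall fun t ht s hs => hK (s, t) ⟨hs, uIoc_subset_uIcc ht⟩
  · exact intervalIntegrable_const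
  · exact Filter.Eventually.of_forall fun t _ s _ => hF s t

/-- The lemma of du Bois-Reymond: if `∫ (f' M + f Q) = 0` for all `C¹` functions `f` that vanish at
the end points, then `M` is a primitive of `Q`. -/
theorem eq_add_integral_of_forall_integral_eq_zero {T : ℝ} (hT : 0 < T) {M Q : ℝ → ℝ}
    (hM : Continuous M) (hQ : Continuous Q)
    (h : ∀ f f' : ℝ → ℝ, Continuous f' → (∀ t, HasDerivAt f (f' t) t) → f 0 = 0 → f T = 0 →
      ∫ t in (0 : ℝ)..T, (f' t * M t + f t * Q t) = 0) :
    ∀ t ∈ Icc 0 T, M t = M 0 + ∫ r in (0 : ℝ)..t, Q r := by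
  have prim : ∀ {q : ℝ → ℝ}, Continuous q → ∀ t,
      HasDerivAt (fun t => ∫ r in (0 : ℝ)..t, q r) (q t) t := fun hq t =>
    (hq.integral_hasStrictDerivAt 0 t).hasDerivAt
  set R : ℝ → ℝ := fun t => ∫ r in (0 : ℝ)..t, Q r with hR
  have hRd := prim hQ
  have hRc : Continuous R := continuous_iff_continuousAt.2 fun t => (hRd t).continuousAt
  set N : ℝ → ℝ := fun t => M t - R t with hN
  have hNc : Continuous N := hM.sub hRc
  -- Integration by parts replaces `f Q` by `-f' R`, the boundary terms being zero, so only `N = M -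
  -- R` is tested against `f'`.
  have key : ∀ f f' : ℝ → ℝ, Continuous f' → (∀ t, HasDerivAt f (f' t) t) → f 0 = 0 → f T = 0 →
      ∫ t in (0 : ℝ)..T, f' t * N t = 0 := by
    intro f f' hf' hf h0 h1
    have hfc : Continuous f := continuous_iff_continuousAt.2 fun t => (hf t).continuousAt
    have e : ∫ t in (0 : ℝ)..T, (f' t * R t + f t * Q t) = f T * R T - f 0 * R 0 :=
      intervalIntegral.integral_eq_sub_of_hasDerivAt (fun t _ => (hf t).mul (hRd t))
        (((hf'.mul hRc).add (hfc.mul hQ)).intervalIntegrable _ _)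
    rw [h0, h1, zero_mul, zero_mul, sub_zero] at e
    have e2 := h f f' hf' hf h0 h1
    have e3 := intervalIntegral.integral_sub (μ := volume)
      (((hf'.mul hM).add (hfc.mul hQ)).intervalIntegrable 0 T)
      (((hf'.mul hRc).add (hfc.mul hQ)).intervalIntegrable 0 T)
    simp only [Pi.add_apply, Pi.mul_apply] at e3
    rw [e, e2, sub_zero] at e3
    refine Eq.trans ?_ e3
    exact intervalIntegral.integral_congr fun t _ => by simp only [hN]; ring
  -- With `c` the mean of `N`, the primitive of `N - c` vanishes at both ends and is an admissible
  -- test function.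
  set c : ℝ := (∫ r in (0 : ℝ)..T, N r) / T with hcdef
  have hint : ∫ r in (0 : ℝ)..T, (N r - c) = 0 := by
    rw [intervalIntegral.integral_sub (hNc.intervalIntegrable _ _) intervalIntegrable_const,
      intervalIntegral.integral_const, smul_eq_mul, hcdef]
    field_simp
    ring
  have hNcc : Continuous fun r => N r - c := hNc.sub continuous_const
  have k1 := key (fun t => ∫ r in (0 : ℝ)..t, (N r - c)) (fun t => N t - c) hNcc (prim hNcc)
    (by simp) hint
  -- `N - c` is orthogonal to `N` by `key` and to constants by the choice of `c`, hence to itself.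
  have hsq : ∫ t in (0 : ℝ)..T, (N t - c) ^ 2 = 0 := by
    have e3 := intervalIntegral.integral_sub (μ := volume)
      ((hNcc.mul hNc).intervalIntegrable 0 T) ((hNcc.mul_const c).intervalIntegrable 0 T)
    rw [intervalIntegral.integral_mul_const, hint, zero_mul, sub_zero] at e3
    simp only [Pi.mul_apply] at e3
    refine Eq.trans ?_ (e3.trans k1)
    exact intervalIntegral.integral_congr fun t _ => by ring
  have hconst : ∀ t ∈ Icc 0 T, N t = c := by
    intro t ht
    by_contra hne
    have := intervalIntegral.integral_pos hT (f := fun t => (N t - c) ^ 2)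
      (hNcc.pow 2).continuousOn (fun x _ => sq_nonneg _)
      ⟨t, ht, by have := sub_ne_zero.2 hne; positivity⟩
    exact this.ne' hsq
  intro t ht
  have a := hconst t ht
  have b := hconst 0 ⟨le_rfl, hT.le⟩
  have d : R 0 = 0 := by simp [hR]
  simp only [hN] at a b
  rw [d, sub_zero] at b
  linarith

/-- A vector-valued form of the lemma of du Bois-Reymond, for curves of linear forms. -/
theorem hasDerivWithinAt_of_forall_integral_eq_zero {E : Type*} [NormedAddCommGroup E]
    [NormedSpace ℝ E] {T : ℝ} (hT : 0 < T) {m q : ℝ → E →L[ℝ] ℝ}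
    (hm : ContinuousOn m (Icc 0 T)) (hq : ContinuousOn q (Icc 0 T))
    (h : ∀ (v : E) (f f' : ℝ → ℝ), Continuous f' → (∀ t, HasDerivAt f (f' t) t) →
      f 0 = 0 → f T = 0 → ∫ t in (0 : ℝ)..T, (f' t * m t v + f t * q t v) = 0) :
    ∀ t ∈ Icc 0 T, HasDerivWithinAt m (q t) (Icc 0 T) t := by
  -- Constant extension beyond the end points gives globally continuous curves and leaves the
  -- integrals over `[0, T]` unchanged.
  set M : ℝ → E →L[ℝ] ℝ := IccExtend hT.le ((Icc 0 T).domRestrict m) with hMdef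
  set Q : ℝ → E →L[ℝ] ℝ := IccExtend hT.le ((Icc 0 T).domRestrict q) with hQdef
  have hM : Continuous M := hm.domRestrict.Icc_extend'
  have hQ : Continuous Q := hq.domRestrict.Icc_extend'
  have eM : ∀ t ∈ Icc 0 T, M t = m t := fun t ht => by
    rw [hMdef, IccExtend_of_mem _ _ ht]; rfl
  have eQ : ∀ t ∈ Icc 0 T, Q t = q t := fun t ht => by
    rw [hQdef, IccExtend_of_mem _ _ ht]; rfl
  have hint : ∀ t ∈ Icc 0 T, m t = M 0 + ∫ r in (0 : ℝ)..t, Q r := by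
    intro t ht
    ext v
    rw [← eM t ht]
    have := eq_add_integral_of_forall_integral_eq_zero hT (hM.clm_apply continuous_const)
      (hQ.clm_apply continuous_const) (M := fun t => M t v) (Q := fun t => Q t v) ?_ t ht
    · rw [this, add_apply,
        ContinuousLinearMap.intervalIntegral_apply (hQ.intervalIntegrable _ _)]
    · intro f f' hf' hf h0 h1
      refine Eq.trans ?_ (h v f f' hf' hf h0 h1)
      refine intervalIntegral.integral_congr fun t ht => ?_
      rw [uIcc_of_le hT.le] at ht
      simp only [eM t ht, eQ t ht]
  intro t ht
  have hd : HasDerivAt (fun t => M 0 + ∫ r in (0 : ℝ)..t, Q r) (Q t) t :=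
    (hQ.integral_hasStrictDerivAt 0 t).hasDerivAt.const_add (M 0)
  rw [← eQ t ht]
  exact hd.hasDerivWithinAt.congr hint (hint t ht)

end CalculusOfVariations

/-! ### Tangent maps between manifolds, written in the model spaces. -/

section Manifold

variable {F₁ F₂ F₃ : Type*} [NormedAddCommGroup F₁] [NormedSpace ℝ F₁]
  [NormedAddCommGroup F₂] [NormedSpace ℝ F₂] [NormedAddCommGroup F₃] [NormedSpace ℝ F₃]
  {N M M' : Type*} [TopologicalSpace N] [ChartedSpace F₁ N] [TopologicalSpace M]
  [ChartedSpace F₂ M] [TopologicalSpace M'] [ChartedSpace F₃ M']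

/-- The tangent map of `f` at `x`, as a linear map between the model spaces. -/
noncomputable def tangentMapAt (f : M → M') (x : M) : F₂ →L[ℝ] F₃ :=
  mfderiv 𝓘(ℝ, F₂) 𝓘(ℝ, F₃) f x

/-- The chain rule with the base point of the outer map given up to equality. -/
theorem hasMFDerivWithinAt_comp_of_eq {f : N → M} {h : M → M'} {s : Set N} {x : N} {y : M}
    {f' : F₁ →L[ℝ] F₂} {h' : F₂ →L[ℝ] F₃}
    (hh : HasMFDerivAt 𝓘(ℝ, F₂) 𝓘(ℝ, F₃) h y h')
    (hf : HasMFDerivWithinAt 𝓘(ℝ, F₁) 𝓘(ℝ, F₂) f s x f') (hy : f x = y) :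
    HasMFDerivWithinAt 𝓘(ℝ, F₁) 𝓘(ℝ, F₃) (h ∘ f) s x (h'.comp f') := by
  subst hy
  exact hh.comp_hasMFDerivWithinAt x hf

theorem hasMFDerivAt_comp_of_eq {f : N → M} {h : M → M'} {x : N} {y : M}
    {f' : F₁ →L[ℝ] F₂} {h' : F₂ →L[ℝ] F₃}
    (hh : HasMFDerivAt 𝓘(ℝ, F₂) 𝓘(ℝ, F₃) h y h')
    (hf : HasMFDerivAt 𝓘(ℝ, F₁) 𝓘(ℝ, F₂) f x f') (hy : f x = y) :
    HasMFDerivAt 𝓘(ℝ, F₁) 𝓘(ℝ, F₃) (h ∘ f) x (h'.comp f') := by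
  subst hy
  exact hh.comp x hf

/-- Typing the derivatives on the model spaces lets them be compared when base points are equal only
propositionally. -/
theorem hasMFDerivAt_unique_clm {f : M → M'} {x : M} {f' g' : F₂ →L[ℝ] F₃}
    (hf : HasMFDerivAt 𝓘(ℝ, F₂) 𝓘(ℝ, F₃) f x f')
    (hg : HasMFDerivAt 𝓘(ℝ, F₂) 𝓘(ℝ, F₃) f x g') : f' = g' :=
  hasMFDerivAt_unique hf hg

/-- The derivative at a fixed point of a family of maps that all send it to the same point depends
smoothly on the parameter. -/
theorem contMDiff_mfderiv_of_const
    [IsManifold 𝓘(ℝ, F₁) 1 N] [IsManifold 𝓘(ℝ, F₂) 1 M] [IsManifold 𝓘(ℝ, F₃) 1 M']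
    {n m : ℕ∞ω} (hmn : m + 1 ≤ n) {f : N → M → M'} {x : M} {y : M'}
    (hf : ContMDiff (𝓘(ℝ, F₁).prod 𝓘(ℝ, F₂)) 𝓘(ℝ, F₃) n (Function.uncurry f))
    (hxy : ∀ z, f z x = y) :
    ContMDiff 𝓘(ℝ, F₁) 𝓘(ℝ, F₂ →L[ℝ] F₃) m
      (fun z => tangentMapAt (F₂ := F₂) (F₃ := F₃) (f z) x) := by
  intro z₀
  have h := ContMDiffAt.mfderiv (x₀ := z₀) f (fun _ => x) (hf (z₀, x)) contMDiffAt_const hmn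
  refine h.congr_of_eventuallyEq (Filter.Eventually.of_forall fun z => ?_)
  dsimp only
  -- Since `f z x` is always `y`, source and target each use a single chart, and the coordinate
  -- changes `e1`, `e2` of the tangent bundles are identities.
  have hs : f z x ∈ (chartAt F₃ (f z₀ x)).source := by
    rw [hxy, hxy]; exact mem_chart_source _ _
  refine Eq.trans ?_ (inTangentCoordinates_eq (f := fun _ : N => x) (g := fun z => f z x)
    (fun z => tangentMapAt (F₂ := F₂) (F₃ := F₃) (f z) x) (mem_chart_source _ _) hs).symm
  ext v
  have e1 : (tangentBundleCore 𝓘(ℝ, F₂) M).coordChange (achart F₂ x) (achart F₂ x) x v = v :=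
    (tangentBundleCore 𝓘(ℝ, F₂) M).coordChange_self _ _ (mem_chart_source _ _) _
  have e2 : ∀ w, (tangentBundleCore 𝓘(ℝ, F₃) M').coordChange (achart F₃ (f z x))
      (achart F₃ (f z₀ x)) (f z x) w = w := by
    intro w
    rw [hxy, hxy]
    exact (tangentBundleCore 𝓘(ℝ, F₃) M').coordChange_self _ _ (mem_chart_source _ _) _
  refine Eq.trans ?_ (e2 _).symm
  exact congrArg (tangentMapAt (F₂ := F₂) (F₃ := F₃) (f z) x) e1.symm

end Manifold

/-! ### Translations, conjugations and the product rule in a Lie group. -/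

section LieGroup

variable {E : Type*} [NormedAddCommGroup E] [NormedSpace ℝ E]

/-- The tangent map of a left translation at the identity, as an endomorphism of the model space. -/
noncomputable def leftMap {G : Type*} [TopologicalSpace G] [ChartedSpace E G] [Group G] (g : G) :
    E →L[ℝ] E :=
  mfderiv 𝓘(ℝ, E) 𝓘(ℝ, E) (fun x : G => g * x) 1

/-- The tangent map of a right translation at the identity. -/
noncomputable def rightMap {G : Type*} [TopologicalSpace G] [ChartedSpace E G] [Group G] (g : G) :
    E →L[ℝ] E :=
  mfderiv 𝓘(ℝ, E) 𝓘(ℝ, E) (fun x : G => x * g) 1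

variable {G : Type*} [TopologicalSpace G] [ChartedSpace E G] [Group G]

variable [LieGroup 𝓘(ℝ, E) (minSmoothness ℝ 3) G]

theorem minSmoothness_three_ne_zero : minSmoothness ℝ 3 ≠ 0 := by simp

theorem hasMFDerivAt_mul_left (g : G) :
    HasMFDerivAt 𝓘(ℝ, E) 𝓘(ℝ, E) (fun x : G => g * x) 1 (leftMap g : E →L[ℝ] E) :=
  ((contMDiff_mul_left (I := 𝓘(ℝ, E)) (n := minSmoothness ℝ 3)
    (a := g)).contMDiffAt.mdifferentiableAt minSmoothness_three_ne_zero).hasMFDerivAt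

theorem hasMFDerivAt_mul_right (g : G) :
    HasMFDerivAt 𝓘(ℝ, E) 𝓘(ℝ, E) (fun x : G => x * g) 1 (rightMap g : E →L[ℝ] E) :=
  ((contMDiff_mul_right (I := 𝓘(ℝ, E)) (n := minSmoothness ℝ 3)
    (a := g)).contMDiffAt.mdifferentiableAt minSmoothness_three_ne_zero).hasMFDerivAt

theorem contMDiff_conj (g : G) :
    ContMDiff 𝓘(ℝ, E) 𝓘(ℝ, E) (minSmoothness ℝ 3) (fun x : G => g * x * g⁻¹) :=
  (contMDiff_mul_left (I := 𝓘(ℝ, E)) (n := minSmoothness ℝ 3) (a := g)).mul contMDiff_const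

theorem hasMFDerivAt_conj (g : G) :
    HasMFDerivAt 𝓘(ℝ, E) 𝓘(ℝ, E) (fun x : G => g * x * g⁻¹) 1 (AdMap E g) :=
  ((contMDiff_conj (E := E) g).contMDiffAt.mdifferentiableAt
    minSmoothness_three_ne_zero).hasMFDerivAt

/-- Derivative at `x = e` of `(g x g⁻¹) g = g x`. -/
theorem rightMap_comp_AdMap (g : G) :
    (rightMap g : E →L[ℝ] E).comp (AdMap E g) = leftMap g := by
  have h := hasMFDerivAt_comp_of_eq (hasMFDerivAt_mul_right (E := E) g)
    (hasMFDerivAt_conj (E := E) g) (by simp)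
  have e : (fun x : G => x * g) ∘ (fun x => g * x * g⁻¹) = fun x => g * x := by
    ext x; simp
  exact hasMFDerivAt_unique_clm h (e ▸ hasMFDerivAt_mul_left (E := E) g)

theorem hasMFDerivAt_mul_left' (g h : G) :
    HasMFDerivAt 𝓘(ℝ, E) 𝓘(ℝ, E) (fun x : G => g * x) h
      (tangentMapAt (fun x : G => g * x) h : E →L[ℝ] E) :=
  ((contMDiff_mul_left (I := 𝓘(ℝ, E)) (n := minSmoothness ℝ 3)
    (a := g)).contMDiffAt.mdifferentiableAt minSmoothness_three_ne_zero).hasMFDerivAt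

theorem hasMFDerivAt_mul_right' (g h : G) :
    HasMFDerivAt 𝓘(ℝ, E) 𝓘(ℝ, E) (fun x : G => x * g) h
      (tangentMapAt (fun x : G => x * g) h : E →L[ℝ] E) :=
  ((contMDiff_mul_right (I := 𝓘(ℝ, E)) (n := minSmoothness ℝ 3)
    (a := g)).contMDiffAt.mdifferentiableAt minSmoothness_three_ne_zero).hasMFDerivAt

theorem tangentMapAt_mul_left_comp_leftMap (g h : G) :
    (tangentMapAt (fun x : G => g * x) h : E →L[ℝ] E).comp (leftMap h) = leftMap (g * h) := by
  have h1 := hasMFDerivAt_comp_of_eq (hasMFDerivAt_mul_left' (E := E) g h)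
    (hasMFDerivAt_mul_left (E := E) h) (by simp)
  have e : (fun x : G => g * x) ∘ (fun x => h * x) = fun x => g * h * x := by
    ext x; simp [mul_assoc]
  exact hasMFDerivAt_unique_clm h1 (e ▸ hasMFDerivAt_mul_left (E := E) (g * h))

/-- Derivative at `x = e` of `g x h = (g h)(h⁻¹ x h)`. This is the source of `Ad_{h⁻¹}` in the
product rule for left logarithmic derivatives. -/
theorem tangentMapAt_mul_right_comp_leftMap (g h : G) :
    (tangentMapAt (fun x : G => x * h) g : E →L[ℝ] E).comp (leftMap g)
      = (leftMap (g * h)).comp (AdMap E h⁻¹) := by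
  have h1 := hasMFDerivAt_comp_of_eq (hasMFDerivAt_mul_right' (E := E) h g)
    (hasMFDerivAt_mul_left (E := E) g) (by simp)
  have h2 := hasMFDerivAt_comp_of_eq (hasMFDerivAt_mul_left (E := E) (g * h))
    (hasMFDerivAt_conj (E := E) h⁻¹) (by simp)
  have e : (fun x : G => x * h) ∘ (fun x => g * x)
      = (fun x => g * h * x) ∘ (fun x => h⁻¹ * x * h⁻¹⁻¹) := by
    ext x; simp [mul_assoc]
  exact hasMFDerivAt_unique_clm h1 (e ▸ h2)

/-- The product rule for the left logarithmic derivatives of curves in a Lie group. -/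
theorem hasMFDerivWithinAt_mul_curve {g c : ℝ → G} {s : Set ℝ} {t : ℝ} {u v : E}
    (hg : HasMFDerivWithinAt 𝓘(ℝ, ℝ) 𝓘(ℝ, E) g s t
      (ContinuousLinearMap.toSpanSingleton ℝ (leftTranslate (g t) u)))
    (hc : HasMFDerivWithinAt 𝓘(ℝ, ℝ) 𝓘(ℝ, E) c s t
      (ContinuousLinearMap.toSpanSingleton ℝ (leftTranslate (c t) v))) :
    HasMFDerivWithinAt 𝓘(ℝ, ℝ) 𝓘(ℝ, E) (fun t => g t * c t) s t
      (ContinuousLinearMap.toSpanSingleton ℝ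
        (leftTranslate (g t * c t) (AdMap E (c t)⁻¹ u + v))) := by
  have hm : MDifferentiableAt (𝓘(ℝ, E).prod 𝓘(ℝ, E)) 𝓘(ℝ, E) (fun p : G × G => p.1 * p.2)
      (g t, c t) :=
    (contMDiff_mul 𝓘(ℝ, E) (minSmoothness ℝ 3)).mdifferentiableAt minSmoothness_three_ne_zero
  have h := hm.hasMFDerivAt.comp_hasMFDerivWithinAt t (hg.prodMk hc)
  -- The derivative of the multiplication is the sum of its two partial derivatives, evaluated by
  -- `e1` and `e2`.
  have e := mfderiv_prod_eq_add_apply (v := ((leftMap (g t) : E →L[ℝ] E) u,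
    (leftMap (c t) : E →L[ℝ] E) v)) hm
  refine h.congr_mfderiv ?_
  refine ContinuousLinearMap.ext_ring ?_
  have e1 := DFunLike.congr_fun (tangentMapAt_mul_right_comp_leftMap (E := E) (g t) (c t)) u
  have e2 := DFunLike.congr_fun (tangentMapAt_mul_left_comp_leftMap (E := E) (g t) (c t)) v
  have l : mfderiv (𝓘(ℝ, E).prod 𝓘(ℝ, E)) 𝓘(ℝ, E) (fun p : G × G => p.1 * p.2) (g t, c t)
      ((leftMap (g t) : E →L[ℝ] E) u, (leftMap (c t) : E →L[ℝ] E) v)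
      = (leftMap (g t * c t) : E →L[ℝ] E) (AdMap E (c t)⁻¹ u + v) :=
    (e.trans (congrArg₂ (fun a b : E => a + b) e1 e2)).trans
      (map_add (leftMap (g t * c t) : E →L[ℝ] E) _ _).symm
  refine Eq.trans ?_ (l.trans (one_smul ℝ _).symm)
  exact congrArg (mfderiv (𝓘(ℝ, E).prod 𝓘(ℝ, E)) 𝓘(ℝ, E) (fun p : G × G => p.1 * p.2)
    (g t, c t)) (Prod.ext (one_smul ℝ _) (one_smul ℝ _))

/-- Conjugations all fix `e`, so their derivatives there form a map between fixed spaces; one of the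
three available derivatives is lost. -/
theorem contMDiff_Ad_two : ContMDiff 𝓘(ℝ, E) 𝓘(ℝ, E →L[ℝ] E) 2 (fun g : G => AdMap E g) := by
  refine contMDiff_mfderiv_of_const (n := minSmoothness ℝ 3) (m := 2) (by simp; norm_num)
    (f := fun g x : G => g * x * g⁻¹) (y := (1 : G)) ?_ (by simp)
  exact (contMDiff_fst.mul contMDiff_snd).mul contMDiff_fst.inv

end LieGroup

/-! ### The derivative of `Ad` is the Lie bracket. -/

section Bracket

open VectorField Filter Topology

/-- The infinitesimal form of the identity `g x = (g x g⁻¹) g` in a local product `m`: if `P`, `Q`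
are the derivatives of left and right translations at `o`, and `P = Q A`, then the derivative of
`A` at `o` is given by brackets of the fields `P v`. -/
theorem lieBracket_eq_of_hasFDerivAt_product {E : Type*} [NormedAddCommGroup E] [NormedSpace ℝ E]
    {m : E × E → E} {o : E} (hm : ContDiffAt ℝ 2 m (o, o)) {P Q A : E → E →L[ℝ] E}
    {A' : E →L[ℝ] E →L[ℝ] E}
    (hP : ∀ᶠ a in 𝓝 o, HasFDerivAt (fun b => m (a, b)) (P a) o)
    (hQ : ∀ᶠ a in 𝓝 o, HasFDerivAt (fun b => m (b, a)) (Q a) o)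
    (hP0 : P o = ContinuousLinearMap.id ℝ E) (hQ0 : Q o = ContinuousLinearMap.id ℝ E)
    (hA0 : A o = ContinuousLinearMap.id ℝ E) (hA : HasFDerivAt A A' o)
    (hPQ : ∀ᶠ a in 𝓝 o, P a = (Q a).comp (A a)) (v w : E) :
    lieBracket ℝ (fun a => P a v) (fun a => P a w) o = A' v w := by
  have hmd : ∀ᶠ p in 𝓝 (o, o), DifferentiableAt ℝ m p := by
    filter_upwards [hm.eventually (by simp)] with p hp using hp.differentiableAt (by simp)
  have tl : Tendsto (fun a : E => (a, o)) (𝓝 o) (𝓝 (o, o)) :=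
    (Continuous.prodMk_left o).tendsto o
  have tr : Tendsto (fun a : E => (o, a)) (𝓝 o) (𝓝 (o, o)) :=
    (Continuous.prodMk_right o).tendsto o
  have eP : ∀ᶠ a in 𝓝 o, P a = (fderiv ℝ m (a, o)).comp (ContinuousLinearMap.inr ℝ E E) := by
    filter_upwards [hP, tl.eventually hmd] with a h1 h2
    exact h1.unique (h2.hasFDerivAt.comp o (hasFDerivAt_prodMk_right a o))
  have eQ : ∀ᶠ a in 𝓝 o, Q a = (fderiv ℝ m (o, a)).comp (ContinuousLinearMap.inl ℝ E E) := by
    filter_upwards [hQ, tr.eventually hmd] with a h1 h2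
    exact h1.unique (h2.hasFDerivAt.comp o (hasFDerivAt_prodMk_left o a))
  set m₂ := fderiv ℝ (fderiv ℝ m) (o, o) with hm₂
  have hd : HasFDerivAt (fderiv ℝ m) m₂ (o, o) :=
    ((hm.fderiv_right (m := 1) (by norm_num)).differentiableAt (by simp)).hasFDerivAt
  have hsymm : ∀ x y, m₂ x y = m₂ y x := fun x y =>
    (hm.isSymmSndFDerivAt (by simp)) x y
  have dP : ∀ x, HasFDerivAt (fun a => P a x)
      ((ContinuousLinearMap.apply ℝ E ((0 : E), x)).comp
        (m₂.comp (ContinuousLinearMap.inl ℝ E E))) o := by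
    intro x
    have h := (ContinuousLinearMap.apply ℝ E ((0 : E), x)).hasFDerivAt.comp o
      (hd.comp (f := fun e => (e, o)) o (hasFDerivAt_prodMk_left o o))
    refine h.congr_of_eventuallyEq ?_
    filter_upwards [eP] with a ha
    rw [ha]; rfl
  have dQ : HasFDerivAt Q
      (((ContinuousLinearMap.compL ℝ E (E × E) E).flip (ContinuousLinearMap.inl ℝ E E)).comp
        (m₂.comp (ContinuousLinearMap.inr ℝ E E))) o := by
    have h := ((ContinuousLinearMap.compL ℝ E (E × E) E).flip
      (ContinuousLinearMap.inl ℝ E E)).hasFDerivAt.comp o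
      (hd.comp o (hasFDerivAt_prodMk_right o o))
    refine h.congr_of_eventuallyEq ?_
    filter_upwards [eQ] with a ha
    rw [ha]; rfl
  have dQA := dQ.clm_apply (hA.clm_apply (hasFDerivAt_const w o))
  -- The derivative at `o` in direction `v` of `P a w = Q a (A a w)`. The symmetry of `m₂` then
  -- makes the mixed term cancel in the bracket, leaving `A' v w`.
  have key : m₂ (v, 0) (0, w) = m₂ (0, v) (w, 0) + A' v w := by
    have h := (dP w).unique (dQA.congr_of_eventuallyEq (by
      filter_upwards [hPQ] with a ha
      rw [ha]; rfl))
    have h := DFunLike.congr_fun h v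
    simpa [hQ0, hA0, add_comm] using h
  rw [lieBracket, (dP v).fderiv, (dP w).fderiv, hP0]
  simp only [ContinuousLinearMap.comp_apply, ContinuousLinearMap.inl_apply,
    ContinuousLinearMap.apply_apply, ContinuousLinearMap.id_apply]
  rw [key, hsymm (0, v) (w, 0)]
  abel

variable {E : Type*} [NormedAddCommGroup E] [NormedSpace ℝ E]
  {G : Type*} [TopologicalSpace G] [ChartedSpace E G] [Group G]
  [LieGroup 𝓘(ℝ, E) (minSmoothness ℝ 3) G]

theorem hasMFDerivAt_extChartAt_symm_self (x : G) :
    HasMFDerivAt 𝓘(ℝ, E) 𝓘(ℝ, E) (extChartAt 𝓘(ℝ, E) x).symm (extChartAt 𝓘(ℝ, E) x x)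
      (ContinuousLinearMap.id ℝ E) := by
  have h := (mdifferentiableWithinAt_extChartAt_symm (I := 𝓘(ℝ, E)) (x := x)
    (mem_extChartAt_target x)).hasMFDerivWithinAt
  rw [mfderivWithin_range_extChartAt_symm] at h
  have hr : range 𝓘(ℝ, E) = univ := by simp
  rw [hr] at h
  exact hasMFDerivWithinAt_univ.1 h

theorem tangentMapAt_extChartAt_self (x : G) :
    (tangentMapAt (extChartAt 𝓘(ℝ, E) x) x : E →L[ℝ] E) = ContinuousLinearMap.id ℝ E :=
  mfderiv_extChartAt_self

theorem hasMFDerivAt_extChartAt' (x : G) {y : G} (hy : y ∈ (extChartAt 𝓘(ℝ, E) x).source) :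
    HasMFDerivAt 𝓘(ℝ, E) 𝓘(ℝ, E) (extChartAt 𝓘(ℝ, E) x) y
      (tangentMapAt (extChartAt 𝓘(ℝ, E) x) y : E →L[ℝ] E) :=
  (mdifferentiableAt_extChartAt (by simpa using hy)).hasMFDerivAt

theorem leftMap_one : (leftMap (1 : G) : E →L[ℝ] E) = ContinuousLinearMap.id ℝ E := by
  have e : (fun x : G => 1 * x) = id := by ext x; simp
  exact hasMFDerivAt_unique_clm (hasMFDerivAt_mul_left (1 : G))
    (e ▸ hasMFDerivAt_id (I := 𝓘(ℝ, E)) (1 : G))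

theorem rightMap_one : (rightMap (1 : G) : E →L[ℝ] E) = ContinuousLinearMap.id ℝ E := by
  have e : (fun x : G => x * 1) = id := by ext x; simp
  exact hasMFDerivAt_unique_clm (hasMFDerivAt_mul_right (1 : G))
    (e ▸ hasMFDerivAt_id (I := 𝓘(ℝ, E)) (1 : G))

theorem AdMap_one : AdMap E (1 : G) = ContinuousLinearMap.id ℝ E := (Ad E G).map_one

theorem hasMFDerivAt_AdMap (g : G) :
    HasMFDerivAt 𝓘(ℝ, E) 𝓘(ℝ, E →L[ℝ] E) (fun g : G => AdMap E g) g
      (tangentMapAt (fun g : G => AdMap E g) g : E →L[ℝ] E →L[ℝ] E) :=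
  (contMDiff_Ad_two.contMDiffAt.mdifferentiableAt two_ne_zero).hasMFDerivAt

/-- The derivative of the adjoint representation is the bracket of left-invariant fields. -/
theorem tangentMapAt_AdMap_apply [FiniteDimensional ℝ E] (v w : E) :
    (tangentMapAt (fun g : G => AdMap E g) 1 : E →L[ℝ] E →L[ℝ] E) v w = bracket G v w := by
  set φ := extChartAt 𝓘(ℝ, E) (1 : G) with hφ
  set o := φ 1 with ho
  have h1 : φ.symm o = 1 := extChartAt_to_inv 1
  have ht : ∀ᶠ a in 𝓝 o, a ∈ φ.target :=
    (isOpen_extChartAt_target (1 : G)).mem_nhds (mem_extChartAt_target 1)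
  have hsrc : ∀ a ∈ φ.target, φ.symm a ∈ φ.source := fun a ha => φ.map_target ha
  have hsymm : HasMFDerivAt 𝓘(ℝ, E) 𝓘(ℝ, E) φ.symm o (ContinuousLinearMap.id ℝ E) :=
    hasMFDerivAt_extChartAt_symm_self (1 : G)
  -- In the chart, `P a x` is the left-invariant field generated by `x`, and `Q a x` the
  -- right-invariant one.
  let P : E → E →L[ℝ] E := fun a => (tangentMapAt φ (φ.symm a) : E →L[ℝ] E).comp
    (leftMap (φ.symm a))
  let Q : E → E →L[ℝ] E := fun a => (tangentMapAt φ (φ.symm a) : E →L[ℝ] E).comp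
    (rightMap (φ.symm a))
  let A : E → E →L[ℝ] E := fun a => AdMap E (φ.symm a)
  have hP : ∀ᶠ a in 𝓝 o, HasFDerivAt (fun b => φ (φ.symm a * φ.symm b)) (P a) o := by
    filter_upwards [ht] with a ha
    have h2 := hasMFDerivAt_comp_of_eq (hasMFDerivAt_extChartAt' (E := E) (1 : G) (hsrc a ha))
      (hasMFDerivAt_comp_of_eq (hasMFDerivAt_mul_left (E := E) (φ.symm a)) hsymm h1)
      (by simp [h1])
    exact hasMFDerivAt_iff_hasFDerivAt.1 h2
  have hQ : ∀ᶠ a in 𝓝 o, HasFDerivAt (fun b => φ (φ.symm b * φ.symm a)) (Q a) o := by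
    filter_upwards [ht] with a ha
    have h2 := hasMFDerivAt_comp_of_eq (hasMFDerivAt_extChartAt' (E := E) (1 : G) (hsrc a ha))
      (hasMFDerivAt_comp_of_eq (hasMFDerivAt_mul_right (E := E) (φ.symm a)) hsymm h1)
      (by simp [h1])
    exact hasMFDerivAt_iff_hasFDerivAt.1 h2
  have hm : ContDiffAt ℝ 2 (fun p : E × E => φ (φ.symm p.1 * φ.symm p.2)) (o, o) := by
    have hs : ContMDiffAt 𝓘(ℝ, E) 𝓘(ℝ, E) (minSmoothness ℝ 3) φ.symm o :=
      (contMDiffOn_extChartAt_symm (1 : G)).contMDiffAt ht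
    have hmul := (hs.comp (o, o) (contMDiffAt_fst (I := 𝓘(ℝ, E)) (J := 𝓘(ℝ, E)))).mul
      (hs.comp (o, o) (contMDiffAt_snd (I := 𝓘(ℝ, E)) (J := 𝓘(ℝ, E))))
    have hφs : ContMDiffAt 𝓘(ℝ, E) 𝓘(ℝ, E) (minSmoothness ℝ 3) φ (φ.symm o * φ.symm o) := by
      rw [h1, mul_one]
      exact contMDiffAt_extChartAt
    have h := hφs.comp (o, o) hmul
    -- Identifies the product manifold structure on `E × E` with its structure as a vector space.
    rw [← modelWithCornersSelf_prod, chartedSpaceSelf_prod] at h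
    exact h.contDiffAt.of_le (by simp; norm_num)
  have hA : HasFDerivAt A (tangentMapAt (fun g : G => AdMap E g) 1 : E →L[ℝ] E →L[ℝ] E) o :=
    hasMFDerivAt_iff_hasFDerivAt.1
      (hasMFDerivAt_comp_of_eq (hasMFDerivAt_AdMap (E := E) (1 : G)) hsymm h1)
  have hid : (tangentMapAt φ (1 : G) : E →L[ℝ] E) = ContinuousLinearMap.id ℝ E :=
    tangentMapAt_extChartAt_self 1
  have key := lieBracket_eq_of_hasFDerivAt_product hm (P := P) (Q := Q) (A := A) hP hQ
    (by simp only [P, h1, hid, leftMap_one, ContinuousLinearMap.comp_id])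
    (by simp only [Q, h1, hid, rightMap_one, ContinuousLinearMap.comp_id])
    (by simp only [A, h1, AdMap_one]) hA
    (Eventually.of_forall fun a => by
      simp only [P, Q, A, ContinuousLinearMap.comp_assoc, rightMap_comp_AdMap]) v w
  rw [← key]
  -- Pulling back by `φ.symm` applies the inverse of its derivative, which on the chart target is
  -- the derivative of `φ`; the result is the field `P a x`.
  have hV : ∀ x : E, (fun a => P a x) =ᶠ[𝓝 o]
      mpullbackWithin 𝓘(ℝ, E) 𝓘(ℝ, E) φ.symm (mulInvariantVectorField
        (I := 𝓘(ℝ, E)) (G := G) (x : GroupLieAlgebra 𝓘(ℝ, E) G)) (range 𝓘(ℝ, E)) := by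
    intro x
    filter_upwards [ht] with a ha
    have hinv := ContinuousLinearMap.inverse_eq
      (mfderivWithin_extChartAt_symm_comp_mfderiv_extChartAt (I := 𝓘(ℝ, E)) (x := (1 : G)) ha)
      (mfderiv_extChartAt_comp_mfderivWithin_extChartAt_symm (I := 𝓘(ℝ, E)) (x := (1 : G)) ha)
    rw [mpullbackWithin_apply]
    exact (DFunLike.congr_fun hinv _).symm
  have hB := mlieBracketWithin_apply (I := 𝓘(ℝ, E)) (s := univ) (x₀ := (1 : G))
    (V := mulInvariantVectorField (I := 𝓘(ℝ, E)) (G := G) (v : GroupLieAlgebra 𝓘(ℝ, E) G))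
    (W := mulInvariantVectorField (I := 𝓘(ℝ, E)) (G := G) (w : GroupLieAlgebra 𝓘(ℝ, E) G))
  have hr : φ.symm ⁻¹' univ ∩ range 𝓘(ℝ, E) = univ := by simp
  -- The manifold bracket is carried back from the chart by the inverse of `dφ` at `e`, which is the
  -- identity.
  have hinv : ∀ z : E, (mfderiv 𝓘(ℝ, E) 𝓘(ℝ, E) (extChartAt 𝓘(ℝ, E) (1 : G)) 1).inverse z = z :=
    DFunLike.congr_fun ((congrArg ContinuousLinearMap.inverse
      (mfderiv_extChartAt_self (I := 𝓘(ℝ, E)) (x := (1 : G)))).trans ContinuousLinearMap.inverse_id)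
  refine ((hV v).lieBracket_vectorField_eq (hV w)).trans
    (Eq.trans ?_ (hB.trans (hinv _)).symm)
  exact (congrFun lieBracketWithin_univ o).symm.trans
    (congrArg (fun s => lieBracketWithin ℝ _ _ s o) hr.symm)

end Bracket

/-! ### The adjoint representation along curves, and its momentum map. -/

section AdjointCurves

open Filter Topology

variable {E : Type*} [NormedAddCommGroup E] [NormedSpace ℝ E]
  {G : Type*} [TopologicalSpace G] [ChartedSpace E G] [Group G]
  [LieGroup 𝓘(ℝ, E) (minSmoothness ℝ 3) G]

/-- Derivative at `x = e` of `Ad_{g x} = Ad_g Ad_x`: it reduces the derivative of `Ad` at any point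
to the one at `e`. -/
theorem tangentMapAt_AdMap_comp_leftMap (g : G) :
    (tangentMapAt (fun g : G => AdMap E g) g : E →L[ℝ] E →L[ℝ] E).comp (leftMap g)
      = (ContinuousLinearMap.compL ℝ E E E (AdMap E g)).comp
        (tangentMapAt (fun g : G => AdMap E g) 1) := by
  have h1 := hasMFDerivAt_comp_of_eq (hasMFDerivAt_AdMap (E := E) g)
    (hasMFDerivAt_mul_left (E := E) g) (mul_one g)
  have h2 := hasMFDerivAt_comp_of_eq
    (ContinuousLinearMap.compL ℝ E E E (AdMap E g)).hasFDerivAt.hasMFDerivAt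
    (hasMFDerivAt_AdMap (E := E) (1 : G)) rfl
  have e : (fun g : G => AdMap E g) ∘ (fun x => g * x)
      = ContinuousLinearMap.compL ℝ E E E (AdMap E g) ∘ fun g : G => AdMap E g := by
    funext x
    exact (Ad E G).map_mul g x
  exact hasMFDerivAt_unique_clm h1 (e ▸ h2)

theorem AdMap_mul (g h : G) : AdMap E (g * h) = (AdMap E g).comp (AdMap E h) :=
  (Ad E G).map_mul g h

theorem AdMap_comp_AdMap_inv (g : G) :
    (AdMap E g).comp (AdMap E g⁻¹) = ContinuousLinearMap.id ℝ E := by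
  rw [← AdMap_mul, mul_inv_cancel, AdMap_one]

/-- A curve through the identity with prescribed velocity, together with its left logarithmic
derivative. -/
theorem exists_curve_through_one (v : E) : ∃ (c : ℝ → G) (κ : ℝ → E),
    ContMDiff 𝓘(ℝ, ℝ) 𝓘(ℝ, E) 2 c ∧ ContDiff ℝ 1 κ ∧
    (∀ r, HasMFDerivAt 𝓘(ℝ, ℝ) 𝓘(ℝ, E) c r
      (ContinuousLinearMap.toSpanSingleton ℝ (leftTranslate (c r) (κ r)))) ∧
    c 0 = 1 ∧ κ 0 = v := by
  set φ := extChartAt 𝓘(ℝ, E) (1 : G) with hφ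
  set o := φ 1 with ho
  obtain ⟨ε, hε, hball⟩ := Metric.isOpen_iff.1 (isOpen_extChartAt_target (I := 𝓘(ℝ, E)) (1 : G)) o
    (mem_extChartAt_target 1)
  set δ : ℝ := ε / (‖v‖ + 1) with hδ
  have hδpos : 0 < δ := by positivity
  have hδv : δ * ‖v‖ < ε := by
    rw [hδ, div_mul_eq_mul_div, div_lt_iff₀ (by positivity)]
    nlinarith
  -- The sine makes the curve global: it has velocity `v` at `0` and stays within `δ‖v‖ < ε` of `o`,
  -- hence in the chart.
  set β : ℝ → E := fun r => o + (δ * Real.sin (r / δ)) • v with hβ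
  have hβt : ∀ r, β r ∈ φ.target := by
    intro r
    apply hball
    rw [Metric.mem_ball, dist_eq_norm, hβ]
    simp only [add_sub_cancel_left, norm_smul, norm_mul, Real.norm_eq_abs, abs_of_pos hδpos]
    have := Real.abs_sin_le_one (r / δ)
    have h0 : 0 ≤ δ * ‖v‖ := by positivity
    nlinarith
  have hβs : ContDiff ℝ 2 β :=
    contDiff_const.add ((contDiff_const.mul (Real.contDiff_sin.comp
      (contDiff_id.div_const δ))).smul contDiff_const)
  have hβ0 : β 0 = o := by simp [hβ]
  have hβd : HasDerivAt β v 0 := by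
    have h1 : HasDerivAt (fun r : ℝ => Real.sin (r / δ)) (Real.cos (0 / δ) * (1 / δ)) 0 :=
      ((hasDerivAt_id (0 : ℝ)).div_const δ).sin
    have h2 := ((h1.const_mul δ).smul_const v).const_add o
    have e : (δ * (Real.cos (0 / δ) * (1 / δ))) • v = v := by
      rw [zero_div, Real.cos_zero, one_mul, mul_one_div_cancel hδpos.ne', one_smul]
    rwa [e] at h2
  set c : ℝ → G := fun r => φ.symm (β r) with hc
  have hc0 : c 0 = 1 := by
    simp only [hc, hβ0]
    exact extChartAt_to_inv 1
  have : LieGroup 𝓘(ℝ, E) 2 G := LieGroup.of_le (n := minSmoothness ℝ 3) (by simp; norm_num)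
  have hcs : ContMDiff 𝓘(ℝ, ℝ) 𝓘(ℝ, E) 2 c :=
    (contMDiffOn_extChartAt_symm (1 : G)).comp_contMDiff hβs.contMDiff hβt
  -- The curves `τ ↦ c(r)⁻¹ c(r + τ)` all pass through `e` at `τ = 0`, so their velocities `κ r`
  -- there lie in one space and depend on `r` in a `C¹` way.
  have hquot : ∀ r, ContMDiff 𝓘(ℝ, ℝ) 𝓘(ℝ, E) 2 (fun τ : ℝ => (c r)⁻¹ * c (r + τ)) := fun r =>
    contMDiff_mul_left.comp (hcs.comp (contDiff_const.add contDiff_id).contMDiff)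
  let κ : ℝ → E := fun r => (tangentMapAt (fun τ : ℝ => (c r)⁻¹ * c (r + τ)) 0 : ℝ →L[ℝ] E) 1
  have hκs : ContDiff ℝ 1 κ := by
    have hadd : ContMDiff (𝓘(ℝ, ℝ).prod 𝓘(ℝ, ℝ)) 𝓘(ℝ, ℝ) 2 (fun p : ℝ × ℝ => p.1 + p.2) :=
      contMDiff_fst.add contMDiff_snd
    have h := contMDiff_mfderiv_of_const (n := 2) (m := 1) (by norm_num)
      (f := fun r τ : ℝ => (c r)⁻¹ * c (r + τ)) (x := (0 : ℝ)) (y := (1 : G))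
      ((hcs.comp contMDiff_fst).inv.mul (hcs.comp hadd)) (by simp)
    exact h.contDiff.clm_apply contDiff_const
  have hcd : ∀ r, HasMFDerivAt 𝓘(ℝ, ℝ) 𝓘(ℝ, E) c r
      (ContinuousLinearMap.toSpanSingleton ℝ (leftTranslate (c r) (κ r))) := by
    intro r
    have h1 : HasMFDerivAt 𝓘(ℝ, ℝ) 𝓘(ℝ, E) (fun τ : ℝ => (c r)⁻¹ * c (r + τ)) 0
        (tangentMapAt (fun τ : ℝ => (c r)⁻¹ * c (r + τ)) 0 : ℝ →L[ℝ] E) :=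
      ((hquot r).contMDiffAt.mdifferentiableAt two_ne_zero).hasMFDerivAt
    have h2 : HasMFDerivAt 𝓘(ℝ, ℝ) 𝓘(ℝ, ℝ) (fun ρ : ℝ => ρ - r) r (ContinuousLinearMap.id ℝ ℝ) :=
      ((hasFDerivAt_id r).sub_const r).hasMFDerivAt
    have h3 := hasMFDerivAt_comp_of_eq (hasMFDerivAt_mul_left (E := E) (c r))
      (hasMFDerivAt_comp_of_eq h1 h2 (sub_self r)) (by simp)
    have e : (fun x => c r * x) ∘ (fun τ : ℝ => (c r)⁻¹ * c (r + τ)) ∘ (fun ρ : ℝ => ρ - r) = c := by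
      funext ρ
      simp
    rw [e] at h3
    refine h3.congr_mfderiv (ContinuousLinearMap.ext_ring ?_)
    exact (one_smul ℝ _).symm
  refine ⟨c, κ, hcs, hκs, hcd, hc0, ?_⟩
  have h1 := hasMFDerivAt_comp_of_eq (hasMFDerivAt_extChartAt_symm_self (E := E) (1 : G))
    hβd.hasFDerivAt.hasMFDerivAt hβ0
  have h2 := DFunLike.congr_fun (hasMFDerivAt_unique_clm h1 (hcd 0)) 1
  have h3 : (leftMap (c 0) : E →L[ℝ] E) = ContinuousLinearMap.id ℝ E := by rw [hc0, leftMap_one]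
  have h4 : (leftMap (c 0) : E →L[ℝ] E) (κ 0) = κ 0 := DFunLike.congr_fun h3 _
  refine Eq.trans (Eq.trans ?_ h2.symm) (one_smul ℝ v)
  exact (h4.symm).trans (one_smul ℝ _).symm

variable [FiniteDimensional ℝ E]

variable (G) in
theorem bracket_swap (v w : E) : -(bracket G v w : E) = bracket G w v := by
  have : CompleteSpace E := FiniteDimensional.complete ℝ E
  exact lie_skew (L := GroupLieAlgebra 𝓘(ℝ, E) G) w v

variable (G) in
theorem ad_swap (v w : E) : -ad G v w = ad G w v := bracket_swap G v w

theorem tangentMapAt_AdMap_one (v : E) :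
    (tangentMapAt (fun g : G => AdMap E g) 1 : E →L[ℝ] E →L[ℝ] E) v = ad G v := by
  ext w
  exact tangentMapAt_AdMap_apply v w

variable (G) in
theorem continuous_ad : Continuous fun v : E => ad G v := by
  simp only [← tangentMapAt_AdMap_one]
  exact ContinuousLinearMap.continuous _

theorem inducedRep_Ad (ξ : E) : inducedRep (Ad E G) ξ = ad G ξ := tangentMapAt_AdMap_one ξ

theorem inducedDualRep_Ad (ξ : E) (α : E →L[ℝ] ℝ) :
    inducedDualRep (Ad E G) ξ α = adDual G ξ α := by
  rw [inducedDualRep, inducedRep_Ad, adDual]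

/-- The generator is `[ξ, x]`, while `ad*_x` pairs `α` with `[x, ξ]`; skew-symmetry gives the sign.
-/
theorem momentumMap_Ad (x : E) (α : E →L[ℝ] ℝ) :
    (momentumMap (Ad E G) x α : E →L[ℝ] ℝ) = -adDual G x α := by
  have h := hasMFDerivAt_comp_of_eq
    (ContinuousLinearMap.apply ℝ E x : (E →L[ℝ] E) →L[ℝ] E).hasFDerivAt.hasMFDerivAt
    (hasMFDerivAt_AdMap (E := E) (1 : G)) rfl
  ext ξ
  have e : infinitesimalGenerator (Ad E G) ξ x = ad G ξ x :=
    (DFunLike.congr_fun h.mfderiv ξ).trans (tangentMapAt_AdMap_apply ξ x)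
  rw [momentumMap_apply, e, ← ad_swap, map_neg]
  rfl

/-- The derivative of the adjoint representation along a curve. -/
theorem hasDerivWithinAt_AdMap_curve {g : ℝ → G} {s : Set ℝ} {t : ℝ} {u : E}
    (hg : HasMFDerivWithinAt 𝓘(ℝ, ℝ) 𝓘(ℝ, E) g s t
      (ContinuousLinearMap.toSpanSingleton ℝ (leftTranslate (g t) u))) :
    HasDerivWithinAt (fun t => AdMap E (g t)) ((AdMap E (g t)).comp (ad G u)) s t := by
  have h : HasFDerivWithinAt (fun t => AdMap E (g t))
      ((tangentMapAt (fun g : G => AdMap E g) (g t) : E →L[ℝ] E →L[ℝ] E).comp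
        (ContinuousLinearMap.toSpanSingleton ℝ ((leftMap (g t) : E →L[ℝ] E) u))) s t :=
    hasMFDerivWithinAt_iff_hasFDerivWithinAt.1
      (hasMFDerivWithinAt_comp_of_eq (hasMFDerivAt_AdMap (E := E) (g t)) hg rfl)
  have h := h.hasDerivWithinAt
  refine h.congr_deriv ?_
  have e := DFunLike.congr_fun (tangentMapAt_AdMap_comp_leftMap (E := E) (g t)) u
  rw [ContinuousLinearMap.comp_apply, ContinuousLinearMap.toSpanSingleton_apply, one_smul]
  refine e.trans ?_
  rw [← tangentMapAt_AdMap_one]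
  rfl

end AdjointCurves

/-! ### The variations `g(t) c(s f(t))` and their velocities. -/

section Variations

variable {E : Type*} [NormedAddCommGroup E] [NormedSpace ℝ E]

theorem hasDerivAt_comp_mul_right {F : Type*} [NormedAddCommGroup F] [NormedSpace ℝ F] {B : ℝ → F}
    (hB : ContDiff ℝ 1 B) (a s : ℝ) :
    HasDerivAt (fun r => B (r * a)) (a • deriv B (s * a)) s :=
  ((hB.differentiable one_ne_zero (s * a)).hasDerivAt).scomp s (hasDerivAt_mul_const a)

/-- The derivative in `s` of the velocity of a variation `g(t) c(s f(t))`. -/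
theorem hasDerivAt_variation_velocity {B : ℝ → E →L[ℝ] E} {κ : ℝ → E} (hB : ContDiff ℝ 1 B)
    (hκ : ContDiff ℝ 1 κ) (x : E) (a b s : ℝ) :
    HasDerivAt (fun r => B (r * a) x + (r * b) • κ (r * a))
      (a • deriv B (s * a) x + ((s * b) • a • deriv κ (s * a) + b • κ (s * a))) s :=
  ((hasDerivAt_comp_mul_right hB a s).clm_apply (hasDerivAt_const s x)).congr_deriv (by simp)
    |>.add ((hasDerivAt_mul_const b).smul (hasDerivAt_comp_mul_right hκ a s))

variable {G : Type*} [TopologicalSpace G] [ChartedSpace E G] [Group G]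

theorem hasMFDerivAt_curve_comp {c : ℝ → G} {σ : ℝ → ℝ} {t a : ℝ} {k : E}
    (hσ : HasDerivAt σ a t)
    (hc : HasMFDerivAt 𝓘(ℝ, ℝ) 𝓘(ℝ, E) c (σ t)
      (ContinuousLinearMap.toSpanSingleton ℝ (leftTranslate (c (σ t)) k))) :
    HasMFDerivAt 𝓘(ℝ, ℝ) 𝓘(ℝ, E) (fun t => c (σ t)) t
      (ContinuousLinearMap.toSpanSingleton ℝ (leftTranslate (c (σ t)) (a • k))) := by
  have h1 : HasMFDerivAt 𝓘(ℝ, ℝ) 𝓘(ℝ, ℝ) σ t (ContinuousLinearMap.toSpanSingleton ℝ a) :=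
    hσ.hasFDerivAt.hasMFDerivAt
  refine (hasMFDerivAt_comp_of_eq hc h1 rfl).congr_mfderiv (ContinuousLinearMap.ext_ring ?_)
  change ((1 : ℝ) • a) • (leftMap (c (σ t)) : E →L[ℝ] E) k
    = (1 : ℝ) • (leftMap (c (σ t)) : E →L[ℝ] E) (a • k)
  rw [one_smul, one_smul, map_smul]

variable [LieGroup 𝓘(ℝ, E) (minSmoothness ℝ 3) G]

theorem contMDiffOn_mul_one {F : Type*} [NormedAddCommGroup F] [NormedSpace ℝ F] {g h : F → G}
    {s : Set F} (hg : ContMDiffOn 𝓘(ℝ, F) 𝓘(ℝ, E) 1 g s)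
    (hh : ContMDiffOn 𝓘(ℝ, F) 𝓘(ℝ, E) 1 h s) :
    ContMDiffOn 𝓘(ℝ, F) 𝓘(ℝ, E) 1 (fun x => g x * h x) s :=
  ((contMDiff_mul 𝓘(ℝ, E) (minSmoothness ℝ 3)).of_le (by simp)).comp_contMDiffOn
    (hg.prodMk hh)

theorem contDiff_AdMap_curve {c : ℝ → G} (hc : ContMDiff 𝓘(ℝ, ℝ) 𝓘(ℝ, E) 2 c) :
    ContDiff ℝ 1 fun r => AdMap E (c r) :=
  (contMDiff_Ad_two.comp hc).contDiff.of_le one_le_two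

theorem IsTrajectory.contMDiffOn_variation {T : ℝ} {g : ℝ → G} {u : ℝ → E}
    (hg : IsTrajectory T g u) {c : ℝ → G} (hc : ContMDiff 𝓘(ℝ, ℝ) 𝓘(ℝ, E) 1 c) {f : ℝ → ℝ}
    (hf : ContDiff ℝ 1 f) :
    ContMDiffOn 𝓘(ℝ, ℝ × ℝ) 𝓘(ℝ, E) 1 (fun q : ℝ × ℝ => g q.2 * c (q.1 * f q.2))
      (univ ×ˢ Icc 0 T) := by
  have h1 : ContDiff ℝ 1 fun q : ℝ × ℝ => q.1 * f q.2 := by fun_prop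
  have h2 : ContMDiffOn 𝓘(ℝ, ℝ × ℝ) 𝓘(ℝ, E) 1 (fun q : ℝ × ℝ => c (q.1 * f q.2))
      (univ ×ˢ Icc 0 T) := (hc.comp h1.contMDiff).contMDiffOn
  have h3 : ContMDiff 𝓘(ℝ, ℝ × ℝ) 𝓘(ℝ, ℝ) 1 (fun q : ℝ × ℝ => q.2) := contDiff_snd.contMDiff
  have h4 : ContMDiffOn 𝓘(ℝ, ℝ × ℝ) 𝓘(ℝ, E) 1 (fun q : ℝ × ℝ => g q.2)
      (univ ×ˢ Icc 0 T) := hg.contMDiffOn.comp h3.contMDiffOn fun q hq => hq.2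
  exact contMDiffOn_mul_one h4 h2

theorem continuousOn_variation_velocity {S : Set ℝ} {u : ℝ → E} (hu : ContinuousOn u S)
    {B : ℝ → E →L[ℝ] E} {κ : ℝ → E} (hB : Continuous B) (hκ : Continuous κ) {f f' : ℝ → ℝ}
    (hf : Continuous f) (hf' : Continuous f') :
    ContinuousOn (fun q : ℝ × ℝ => B (q.1 * f q.2) (u q.2) + (q.1 * f' q.2) • κ (q.1 * f q.2))
      (univ ×ˢ S) := by
  have h1 : ContinuousOn (fun q : ℝ × ℝ => u q.2) (univ ×ˢ S) :=
    hu.comp continuousOn_snd fun q hq => hq.2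
  have h2 : Continuous fun q : ℝ × ℝ => B (q.1 * f q.2) := hB.comp (by fun_prop)
  have h3 : Continuous fun q : ℝ × ℝ => κ (q.1 * f q.2) := hκ.comp (by fun_prop)
  exact (h2.continuousOn.clm_apply h1).add (Continuous.continuousOn (by fun_prop))

theorem continuousOn_variation_velocity_deriv {S : Set ℝ} {u : ℝ → E} (hu : ContinuousOn u S)
    {B : ℝ → E →L[ℝ] E} {κ : ℝ → E} (hB : ContDiff ℝ 1 B) (hκ : ContDiff ℝ 1 κ) {f f' : ℝ → ℝ}
    (hf : Continuous f) (hf' : Continuous f') :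
    ContinuousOn (fun q : ℝ × ℝ => f q.2 • deriv B (q.1 * f q.2) (u q.2)
      + ((q.1 * f' q.2) • f q.2 • deriv κ (q.1 * f q.2) + f' q.2 • κ (q.1 * f q.2)))
      (univ ×ˢ S) := by
  have h1 : ContinuousOn (fun q : ℝ × ℝ => u q.2) (univ ×ˢ S) :=
    hu.comp continuousOn_snd fun q hq => hq.2
  have h2 : Continuous fun q : ℝ × ℝ => deriv B (q.1 * f q.2) :=
    (hB.continuous_deriv le_rfl).comp (by fun_prop)
  have h3 : Continuous fun q : ℝ × ℝ => κ (q.1 * f q.2) := hκ.continuous.comp (by fun_prop)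
  have h4 : Continuous fun q : ℝ × ℝ => deriv κ (q.1 * f q.2) :=
    (hκ.continuous_deriv le_rfl).comp (by fun_prop)
  exact ((hf.comp continuous_snd).continuousOn.smul (h2.continuousOn.clm_apply h1)).add
    (Continuous.continuousOn (by fun_prop))

theorem contDiff_AdMap_inv_curve {c : ℝ → G} (hc : ContMDiff 𝓘(ℝ, ℝ) 𝓘(ℝ, E) 2 c) :
    ContDiff ℝ 1 fun r => AdMap E (c r)⁻¹ := by
  have : LieGroup 𝓘(ℝ, E) 2 G := LieGroup.of_le (n := minSmoothness ℝ 3) (by simp; norm_num)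
  exact contDiff_AdMap_curve hc.inv

theorem contDiff_one_of_hasDerivAt {f f' : ℝ → ℝ} (hf' : Continuous f')
    (hf : ∀ t, HasDerivAt f (f' t) t) : ContDiff ℝ 1 f :=
  contDiff_one_iff_deriv.2
    ⟨fun t => (hf t).differentiableAt, by rwa [funext fun t => (hf t).deriv]⟩

/-- Under multiplication on the right, `u` enters the new velocity linearly through `Ad_{c⁻¹}` and
is never differentiated, so continuity of `u` suffices. -/
theorem IsTrajectory.mul_curve {T : ℝ} {g : ℝ → G} {u : ℝ → E} (hg : IsTrajectory T g u)
    {c : ℝ → G} {κ : ℝ → E} (hc : ContMDiff 𝓘(ℝ, ℝ) 𝓘(ℝ, E) 2 c) (hκ : ContDiff ℝ 1 κ)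
    (hcκ : ∀ r, HasMFDerivAt 𝓘(ℝ, ℝ) 𝓘(ℝ, E) c r
      (ContinuousLinearMap.toSpanSingleton ℝ (leftTranslate (c r) (κ r))))
    {f f' : ℝ → ℝ} (hf' : Continuous f') (hf : ∀ t, HasDerivAt f (f' t) t) (s : ℝ) :
    IsTrajectory T (fun t => g t * c (s * f t))
      (fun t => AdMap E (c (s * f t))⁻¹ (u t) + (s * f' t) • κ (s * f t)) where
  contMDiffOn := by
    have h1 : ContMDiff 𝓘(ℝ, ℝ) 𝓘(ℝ, ℝ × ℝ) 1 (fun t : ℝ => (s, t)) :=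
      (contDiff_prodMk_right s).contMDiff
    exact (hg.contMDiffOn_variation (hc.of_le one_le_two)
      (contDiff_one_of_hasDerivAt hf' hf)).comp h1.contMDiffOn fun t ht => ⟨mem_univ _, ht⟩
  continuousOn := by
    have hfc : Continuous f := (contDiff_one_of_hasDerivAt hf' hf).continuous
    have h1 : Continuous fun t : ℝ => s * f t := by fun_prop
    have h2 : Continuous fun t : ℝ => AdMap E (c (s * f t))⁻¹ :=
      (contDiff_AdMap_inv_curve hc).continuous.comp h1
    have h3 : Continuous fun t : ℝ => κ (s * f t) := hκ.continuous.comp h1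
    have h4 : Continuous fun t : ℝ => (s * f' t) • κ (s * f t) := by fun_prop
    exact (h2.continuousOn.clm_apply hg.continuousOn).add h4.continuousOn
  velocity t ht :=
    hasMFDerivWithinAt_mul_curve (g := g) (c := fun t => c (s * f t)) (u := u t)
      (v := (s * f' t) • κ (s * f t)) (hg.velocity t ht)
      (hasMFDerivAt_curve_comp (σ := fun t => s * f t) ((hf t).const_mul s)
        (hcκ (s * f t))).hasMFDerivWithinAt

/-- The variation `(s, t) ↦ g(t) c(s f(t))` of a trajectory. -/
theorem IsTrajectory.isVariation_mul {T : ℝ} {g : ℝ → G} {u : ℝ → E} (hg : IsTrajectory T g u)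
    {c : ℝ → G} {κ : ℝ → E} (hc : ContMDiff 𝓘(ℝ, ℝ) 𝓘(ℝ, E) 2 c) (hκ : ContDiff ℝ 1 κ)
    (hcκ : ∀ r, HasMFDerivAt 𝓘(ℝ, ℝ) 𝓘(ℝ, E) c r
      (ContinuousLinearMap.toSpanSingleton ℝ (leftTranslate (c r) (κ r))))
    (hc0 : c 0 = 1) {f f' : ℝ → ℝ} (hf' : Continuous f') (hf : ∀ t, HasDerivAt f (f' t) t)
    (hf0 : f 0 = 0) (hfT : f T = 0) :
    IsVariation T g u 1 (fun s t => g t * c (s * f t))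
      (fun s t => AdMap E (c (s * f t))⁻¹ (u t) + (s * f' t) • κ (s * f t)) where
  pos := one_pos
  curve_zero t _ := by simp [hc0]
  velocity_zero t _ := by simp [hc0, AdMap_one]
  left_end s _ := by simp [hc0, hf0]
  right_end s _ := by simp [hc0, hfT]
  trajectory s _ := hg.mul_curve hc hκ hcκ hf' hf s
  contMDiffOn := (hg.contMDiffOn_variation (hc.of_le one_le_two)
    (contDiff_one_of_hasDerivAt hf' hf)).mono (prod_mono (subset_univ _) le_rfl)
  continuousOn_velocity := (continuousOn_variation_velocity hg.continuousOn
    (contDiff_AdMap_inv_curve hc).continuous hκ.continuous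
    (contDiff_one_of_hasDerivAt hf' hf).continuous hf').mono (prod_mono (subset_univ _) le_rfl)
  exists_deriv := ⟨_, fun s _ t _ => hasDerivAt_variation_velocity
      (contDiff_AdMap_inv_curve hc) hκ (u t) (f t) (f' t) s,
    (continuousOn_variation_velocity_deriv hg.continuousOn
      (contDiff_AdMap_inv_curve hc) hκ (contDiff_one_of_hasDerivAt hf' hf).continuous hf').mono
        (prod_mono (subset_univ _) le_rfl)⟩

end Variations

/-! ### Reduction of the Lagrangian by invariance. -/

section Extremals

variable {E : Type*} [NormedAddCommGroup E] [NormedSpace ℝ E]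
  {G : Type*} [TopologicalSpace G] [ChartedSpace E G] [Group G]
  [LieGroup 𝓘(ℝ, E) (minSmoothness ℝ 3) G]
  {P : ControlProblem E G E}

theorem ControlProblem.Assumptions.contDiff_C (hP : P.Assumptions (Ad E G)) :
    ContDiff ℝ 1 (P.C 1) :=
  (hP.contMDiff_C.comp (contMDiff_const.prodMk contMDiff_id (I := 𝓘(ℝ, P.k)))).contDiff

theorem ControlProblem.Assumptions.contDiff_Vext (hP : P.Assumptions (Ad E G)) :
    ContDiff ℝ 1 (P.Vext 1) :=
  (hP.contMDiff_Vext.comp (contMDiff_const.prodMk contMDiff_id (I := 𝓘(ℝ, E →L[ℝ] ℝ)))).contDiff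

variable [FiniteDimensional ℝ E]

/-- By invariance, the augmented Lagrangian reduces to a function on the Lie algebra. -/
theorem ControlProblem.Assumptions.augmentedLagrangian_eq (hP : P.Assumptions (Ad E G)) (g : G)
    (u : E) (l : P.p →L[ℝ] ℝ) (α : E →L[ℝ] ℝ) :
    P.augmentedLagrangian g u l α = P.C 1 (P.projK (u - P.e₀)) + P.Vext 1 (α.comp (AdMap E g))
      + l (P.projP (u - P.e₀)) := by
  -- Both invariances are used at `h = e`; for the potential the covector is `Ad*_g α`, which
  -- `Ad*_{g⁻¹}` sends back to `α`.
  have h1 := hP.C_invariant g 1 (P.projK (u - P.e₀))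
  have h2 := hP.Vext_invariant g 1 (α.comp (AdMap E g))
  have e : dualRep (Ad E G) g⁻¹ (α.comp (AdMap E g)) = α := by
    change (α.comp (AdMap E g)).comp (AdMap E g⁻¹) = α
    rw [ContinuousLinearMap.comp_assoc, AdMap_comp_AdMap_inv, ContinuousLinearMap.comp_id]
  rw [mul_one] at h1 h2
  rw [e] at h2
  rw [ControlProblem.augmentedLagrangian, h1, h2]

end Extremals

/-! ### First derivative of the reduced action. -/

section ReducedAction

/-- The curves are continuous only on `[0, T]`, while differentiation of the action is stated for
globally continuous data. -/
theorem exists_continuous_extension {F : Type*} [TopologicalSpace F] {T : ℝ} (hT : 0 ≤ T)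
    {u : ℝ → F} (hu : ContinuousOn u (Icc 0 T)) :
    ∃ v : ℝ → F, Continuous v ∧ ∀ t ∈ Icc 0 T, v t = u t :=
  ⟨IccExtend hT ((Icc 0 T).domRestrict u), hu.domRestrict.Icc_extend',
    fun t ht => by rw [IccExtend_of_mem _ _ ht]; rfl⟩

/-- Differentiation of the reduced action along a family of velocities `W s` and group elements
`α ∘ A (s f)`. -/
theorem hasDerivAt_reducedAction {E K Q : Type*} [NormedAddCommGroup E] [NormedSpace ℝ E]
    [NormedAddCommGroup K] [NormedSpace ℝ K] [NormedAddCommGroup Q] [NormedSpace ℝ Q]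
    {C : K → ℝ} {V : (E →L[ℝ] ℝ) → ℝ} (hC : ContDiff ℝ 1 C) (hV : ContDiff ℝ 1 V)
    (pK : E →L[ℝ] K) (pP : E →L[ℝ] Q) (e : E) {W W' : ℝ → ℝ → E}
    (hW : ∀ s t, HasDerivAt (fun r => W r t) (W' s t) s)
    (hWc : Continuous fun q : ℝ × ℝ => W q.1 q.2)
    (hWc' : Continuous fun q : ℝ × ℝ => W' q.1 q.2)
    {A : ℝ → E →L[ℝ] E} (hA : ContDiff ℝ 1 A) {α : ℝ → E →L[ℝ] ℝ} (hα : Continuous α)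
    {l : ℝ → Q →L[ℝ] ℝ} (hl : Continuous l) {f : ℝ → ℝ} (hf : Continuous f) (T s : ℝ) :
    HasDerivAt (fun s => ∫ t in (0 : ℝ)..T, (C (pK (W s t - e)) + V ((α t).comp (A (s * f t)))
        + l t (pP (W s t - e))))
      (∫ t in (0 : ℝ)..T, (fderiv ℝ C (pK (W s t - e)) (pK (W' s t))
        + fderiv ℝ V ((α t).comp (A (s * f t))) ((α t).comp (f t • deriv A (s * f t)))
        + l t (pP (W' s t)))) s := by
  have hCc : Continuous (fderiv ℝ C) := hC.continuous_fderiv one_ne_zero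
  have hVc : Continuous (fderiv ℝ V) := hV.continuous_fderiv one_ne_zero
  have hC0 := hC.continuous
  have hV0 := hV.continuous
  have hAc : Continuous fun q : ℝ × ℝ => A (q.1 * f q.2) := hA.continuous.comp (by fun_prop)
  have hAc' : Continuous fun q : ℝ × ℝ => deriv A (q.1 * f q.2) :=
    (hA.continuous_deriv le_rfl).comp (by fun_prop)
  have hα2 : Continuous fun q : ℝ × ℝ => α q.2 := hα.comp continuous_snd
  have hl2 : Continuous fun q : ℝ × ℝ => l q.2 := hl.comp continuous_snd
  have hpK : Continuous fun q : ℝ × ℝ => pK (W q.1 q.2 - e) :=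
    pK.continuous.comp (hWc.sub continuous_const)
  have hpP : Continuous fun q : ℝ × ℝ => pP (W q.1 q.2 - e) :=
    pP.continuous.comp (hWc.sub continuous_const)
  refine hasDerivAt_intervalIntegral_of_continuous
    (F := fun s t => C (pK (W s t - e)) + V ((α t).comp (A (s * f t))) + l t (pP (W s t - e)))
    (F' := fun s t => fderiv ℝ C (pK (W s t - e)) (pK (W' s t))
        + fderiv ℝ V ((α t).comp (A (s * f t))) ((α t).comp (f t • deriv A (s * f t)))
        + l t (pP (W' s t))) (fun s t => ?_) (fun s => ?_) ?_ s
  · have h1 : HasDerivAt (fun r => W r t - e) (W' s t) s := (hW s t).sub_const e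
    have h2 := (hC.differentiable one_ne_zero (pK (W s t - e))).hasFDerivAt.comp_hasDerivAt s
      (pK.hasFDerivAt.comp_hasDerivAt s h1)
    have h3 : HasDerivAt (fun r => (α t).comp (A (r * f t)))
        ((α t).comp (f t • deriv A (s * f t))) s :=
      (ContinuousLinearMap.compL ℝ E E ℝ (α t)).hasFDerivAt.comp_hasDerivAt s
        (hasDerivAt_comp_mul_right hA (f t) s)
    have h4 := (hV.differentiable one_ne_zero
      ((α t).comp (A (s * f t)))).hasFDerivAt.comp_hasDerivAt s h3
    have h5 := (l t).hasFDerivAt.comp_hasDerivAt s (pP.hasFDerivAt.comp_hasDerivAt s h1)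
    exact (h2.add h4).add h5
  · have h : Continuous fun q : ℝ × ℝ => C (pK (W q.1 q.2 - e))
        + V ((α q.2).comp (A (q.1 * f q.2))) + l q.2 (pP (W q.1 q.2 - e)) :=
      ((hC0.comp hpK).add (hV0.comp (hα2.clm_comp hAc))).add (hl2.clm_apply hpP)
    exact h.comp (Continuous.prodMk_right s)
  · have h1 := (hCc.comp hpK).clm_apply (pK.continuous.comp hWc')
    have h2 := (hVc.comp (hα2.clm_comp hAc)).clm_apply
      (hα2.clm_comp ((hf.comp continuous_snd).smul hAc'))
    have h3 := hl2.clm_apply (pP.continuous.comp hWc')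
    exact (h1.add h2).add h3

end ReducedAction

/-! ### From critical trajectories to the Euler–Poincaré equations. -/

section Extremals

variable {E : Type*} [NormedAddCommGroup E] [NormedSpace ℝ E] [FiniteDimensional ℝ E]
  {G : Type*} [TopologicalSpace G] [ChartedSpace E G] [Group G]
  [LieGroup 𝓘(ℝ, E) (minSmoothness ℝ 3) G]
  {P : ControlProblem E G E} {g : ℝ → G} {u : ℝ → E} {l : ℝ → P.p →L[ℝ] ℝ}

theorem IsTrajectory.hasDerivWithinAt_comp_AdMap {T : ℝ} (hg : IsTrajectory T g u)
    (α : E →L[ℝ] ℝ) {t : ℝ} (ht : t ∈ Icc 0 T) :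
    HasDerivWithinAt (fun t => α.comp (AdMap E (g t))) (adDual G (u t) (α.comp (AdMap E (g t))))
      (Icc 0 T) t :=
  (ContinuousLinearMap.compL ℝ E E ℝ α).hasFDerivAt.comp_hasDerivWithinAt t
    (hasDerivWithinAt_AdMap_curve (hg.velocity t ht))

/-- With `x = ∂F/∂α`, skew-symmetry gives `-α([x, v]) = α([v, x])`, which is the derivative of `F`
along `α ∘ ad_v`: the form in which the potential enters the first variation. -/
theorem momentumField_apply (u : E) (m α : E →L[ℝ] ℝ) (F : (E →L[ℝ] ℝ) → ℝ) (v : E) :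
    (adDual G u m - adDual G (dualGradient F α) α) v
      = m (ad G u v) + fderiv ℝ F α (α.comp (ad G v)) := by
  rw [← apply_dualGradient]
  change m (ad G u v) - α (ad G (dualGradient F α) v)
    = m (ad G u v) + α (ad G v (dualGradient F α))
  rw [← ad_swap G (dualGradient F α) v, map_neg, sub_eq_add_neg]

/-- The derivative at the identity of `r ↦ Ad_{c(r)⁻¹}`. -/
theorem deriv_AdMap_inv_curve {c : ℝ → G} {v : E} (hc : ContMDiff 𝓘(ℝ, ℝ) 𝓘(ℝ, E) 2 c)
    (hc0 : c 0 = 1) (h : HasDerivAt (fun r => AdMap E (c r)) (ad G v) 0) :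
    deriv (fun r => AdMap E (c r)⁻¹) 0 = -ad G v := by
  have hB := ((contDiff_AdMap_inv_curve hc).differentiable one_ne_zero 0).hasDerivAt
  -- Differentiates `Ad_{c(r)} Ad_{c(r)⁻¹} = id` at `r = 0`.
  have h1 := h.clm_comp hB
  have e : (fun r => (AdMap E (c r)).comp (AdMap E (c r)⁻¹))
      = fun _ => ContinuousLinearMap.id ℝ E := funext fun r => AdMap_comp_AdMap_inv (c r)
  rw [e] at h1
  have h2 := h1.unique (hasDerivAt_const _ _)
  simp only [hc0, inv_one, AdMap_one, ContinuousLinearMap.comp_id,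
    ContinuousLinearMap.id_comp] at h2
  exact eq_neg_of_add_eq_zero_right h2

/-- The weak form of the momentum equation. -/
theorem IsNormalExtremal.integral_eq_zero (hP : P.Assumptions (Ad E G))
    (h : IsNormalExtremal P g u l) (v : E) {f f' : ℝ → ℝ} (hf' : Continuous f')
    (hf : ∀ t, HasDerivAt f (f' t) t) (hf0 : f 0 = 0) (hfT : f P.T = 0) :
    ∫ t in (0 : ℝ)..P.T, (f' t * P.costMomentum (u t) (l t) v
      + f t * (adDual G (u t) (P.costMomentum (u t) (l t))
        - adDual G (dualGradient (P.Vext 1) (P.α₀.comp (AdMap E (g t))))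
          (P.α₀.comp (AdMap E (g t)))) v) = 0 := by
  have hT := P.T_pos.le
  have hg := h.admissible.trajectory
  obtain ⟨c, κ, hc, hκ, hcκ, hc0, hκ0⟩ := exists_curve_through_one (G := G) v
  have hfc : Continuous f := (contDiff_one_of_hasDerivAt hf' hf).continuous
  have hA : ContDiff ℝ 1 fun r => AdMap E (c r) := contDiff_AdMap_curve hc
  have hB : ContDiff ℝ 1 fun r => AdMap E (c r)⁻¹ := contDiff_AdMap_inv_curve hc
  have hA0 : HasDerivAt (fun r => AdMap E (c r)) (ad G v) 0 := by
    have h1 := hasDerivWithinAt_AdMap_curve (hcκ 0).hasMFDerivWithinAt (s := univ)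
    rwa [hc0, AdMap_one, hκ0, ContinuousLinearMap.id_comp, hasDerivWithinAt_univ] at h1
  have hB0 := deriv_AdMap_inv_curve hc hc0 hA0
  obtain ⟨U, hU, eU⟩ := exists_continuous_extension hT hg.continuousOn
  obtain ⟨L, hL, eL⟩ := exists_continuous_extension hT h.contDiffOn.continuousOn
  obtain ⟨α, hα, eα⟩ := exists_continuous_extension hT
    (fun t ht => (hg.hasDerivWithinAt_comp_AdMap P.α₀ ht).continuousWithinAt :
      ContinuousOn (fun t => P.α₀.comp (AdMap E (g t))) (Icc 0 P.T))
  have hWc : Continuous fun q : ℝ × ℝ => AdMap E (c (q.1 * f q.2))⁻¹ (U q.2)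
      + (q.1 * f' q.2) • κ (q.1 * f q.2) := by
    rw [← continuousOn_univ, ← univ_prod_univ]
    exact continuousOn_variation_velocity hU.continuousOn hB.continuous hκ.continuous hfc hf'
  have hWc' : Continuous fun q : ℝ × ℝ => f q.2 • deriv (fun r => AdMap E (c r)⁻¹) (q.1 * f q.2)
      (U q.2) + ((q.1 * f' q.2) • f q.2 • deriv κ (q.1 * f q.2) + f' q.2 • κ (q.1 * f q.2)) := by
    rw [← continuousOn_univ, ← univ_prod_univ]
    exact continuousOn_variation_velocity_deriv hU.continuousOn hB hκ hfc hf'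
  have hd := hasDerivAt_reducedAction hP.contDiff_C hP.contDiff_Vext P.projK P.projP P.e₀
    (W := fun s t => AdMap E (c (s * f t))⁻¹ (U t) + (s * f' t) • κ (s * f t))
    (fun s t => hasDerivAt_variation_velocity hB hκ (U t) (f t) (f' t) s) hWc hWc' hA hα hL hfc
    P.T 0
  have hcrit := h.critical 1 _ _ (hg.isVariation_mul hc hκ hcκ hc0 hf' hf hf0 hfT)
  have hfun : (fun s => ∫ t in (0 : ℝ)..P.T, P.augmentedLagrangian (g t * c (s * f t))
      (AdMap E (c (s * f t))⁻¹ (u t) + (s * f' t) • κ (s * f t)) (l t) P.α₀)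
      = fun s => ∫ t in (0 : ℝ)..P.T,
        (P.C 1 (P.projK (AdMap E (c (s * f t))⁻¹ (U t) + (s * f' t) • κ (s * f t) - P.e₀))
        + P.Vext 1 ((α t).comp (AdMap E (c (s * f t))))
        + L t (P.projP (AdMap E (c (s * f t))⁻¹ (U t) + (s * f' t) • κ (s * f t) - P.e₀))) := by
    funext s
    refine intervalIntegral.integral_congr fun t ht => ?_
    rw [uIcc_of_le hT] at ht
    simp only [hP.augmentedLagrangian_eq, eU t ht, eL t ht, eα t ht, AdMap_mul,
      ContinuousLinearMap.comp_assoc]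
  rw [hfun] at hcrit
  -- The derivative of the action at `s = 0` is the computed integral, and is zero by criticality.
  -- It remains to match integrands, with `-f ad_v u = f ad_u v` coming from `Ad_{c⁻¹}`.
  refine Eq.trans ?_ (hd.unique hcrit)
  refine intervalIntegral.integral_congr fun t ht => ?_
  rw [uIcc_of_le hT] at ht
  simp only [momentumField_apply, zero_mul, hc0, inv_one, AdMap_one, zero_smul, add_zero, zero_add,
    ContinuousLinearMap.id_apply, ContinuousLinearMap.comp_id, hB0, hA0.deriv, hκ0, eU t ht,
    eL t ht, eα t ht, ControlProblem.costMomentum, neg_apply, ad_swap,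
    add_apply, ContinuousLinearMap.comp_apply, map_add, map_smul, smul_eq_mul,
    ContinuousLinearMap.comp_smul]
  ring

theorem IsNormalExtremal.continuousOn_costMomentum (hP : P.Assumptions (Ad E G))
    (h : IsNormalExtremal P g u l) :
    ContinuousOn (fun t => P.costMomentum (u t) (l t)) (Icc 0 P.T) := by
  have hu := h.admissible.trajectory.continuousOn
  have h1 : ContinuousOn (fun t => P.projK (u t - P.e₀)) (Icc 0 P.T) :=
    P.projK.continuous.comp_continuousOn (hu.sub continuousOn_const)
  have h2 := (hP.contDiff_C.continuous_fderiv one_ne_zero).comp_continuousOn h1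
  exact (h2.clm_comp continuousOn_const).add (h.contDiffOn.continuousOn.clm_comp continuousOn_const)

theorem IsNormalExtremal.adjointEulerPoincareEquations (hP : P.Assumptions (Ad E G))
    (h : IsNormalExtremal P g u l) :
    AdjointEulerPoincareEquations P u l (fun t => P.α₀.comp (Ad E G (g t))) where
  momentum := by
    have hg := h.admissible.trajectory
    refine hasDerivWithinAt_of_forall_integral_eq_zero P.T_pos (h.continuousOn_costMomentum hP) ?_
      fun v f f' hf' hf hf0 hfT => h.integral_eq_zero hP v hf' hf hf0 hfT
    -- In finite dimension continuity may be tested on each `v`, where `momentumField_apply`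
    -- replaces `dualGradient` by the continuous derivative of the potential.
    refine continuousOn_clm_apply.2 fun v => ?_
    have hα : ContinuousOn (fun t => P.α₀.comp (AdMap E (g t))) (Icc 0 P.T) :=
      fun t ht => (hg.hasDerivWithinAt_comp_AdMap P.α₀ ht).continuousWithinAt
    have h1 : ContinuousOn (fun t => P.costMomentum (u t) (l t) (ad G (u t) v)) (Icc 0 P.T) :=
      (h.continuousOn_costMomentum hP).clm_apply
        (((continuous_ad G).comp_continuousOn hg.continuousOn).clm_apply continuousOn_const)
    have h2 := ((hP.contDiff_Vext.continuous_fderiv one_ne_zero).comp_continuousOn hα).clm_apply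
      (hα.clm_comp (continuousOn_const (c := ad G v)))
    exact (h1.add h2).congr fun t _ => momentumField_apply _ _ _ _ _
  advection t ht := h.admissible.trajectory.hasDerivWithinAt_comp_AdMap P.α₀ ht
  initial := by
    rw [h.admissible.left_end]

theorem eulerPoincareEquations_iff (α : ℝ → E →L[ℝ] ℝ) :
    EulerPoincareEquations P (Ad E G) u l α ↔ AdjointEulerPoincareEquations P u l α := by
  constructor
  · rintro ⟨h1, h2, h3⟩
    refine ⟨fun t ht => ?_, fun t ht => ?_, h3⟩
    · simpa only [momentumMap_Ad, sub_eq_add_neg] using h1 t ht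
    · simpa only [inducedDualRep_Ad] using h2 t ht
  · rintro ⟨h1, h2, h3⟩
    refine ⟨fun t ht => ?_, fun t ht => ?_, h3⟩
    · simpa only [momentumMap_Ad, sub_eq_add_neg] using h1 t ht
    · simpa only [inducedDualRep_Ad] using h2 t ht

end Extremals

end SymmetryBreaking

theorem corollary5 {E : Type*} [NormedAddCommGroup E] [NormedSpace ℝ E] [FiniteDimensional ℝ E]
    {G : Type*} [TopologicalSpace G] [ChartedSpace E G] [Group G]
    [LieGroup 𝓘(ℝ, E) (minSmoothness ℝ 3) G]
    (P : ControlProblem E G E) (hP : P.Assumptions (Ad E G)) :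
    (∀ (x : E) (α : E →L[ℝ] ℝ), (momentumMap (Ad E G) x α : E →L[ℝ] ℝ) = -adDual G x α) ∧
    (∀ (u : ℝ → E) (l : ℝ → P.p →L[ℝ] ℝ) (α : ℝ → E →L[ℝ] ℝ),
      EulerPoincareEquations P (Ad E G) u l α ↔ AdjointEulerPoincareEquations P u l α) ∧
    (∀ (g : ℝ → G) (u : ℝ → E) (l : ℝ → P.p →L[ℝ] ℝ), IsNormalExtremal P g u l →
      AdjointEulerPoincareEquations P u l (fun t => P.α₀.comp (Ad E G (g t)))) :=
  ⟨momentumMap_Ad, fun _ _ α => eulerPoincareEquations_iff α,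
    fun _ _ _ h => h.adjointEulerPoincareEquations hP⟩
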